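/- Let $\mathcal H=\mathbb C^{16}\otimes L^2(\mathbb R^3)=L^2(\mathbb R^3;\mathbb C^4\otimes\mathbb C^4)$, let $\hat{\vec p}=-i\nabla$, and let $\vec\alpha=(\alpha_1,\alpha_2,\alpha_3)$, $\beta$ be the $4\times4$ Dirac matrices in the standard representation, i.e. $\alpha_j=\begin{pmatrix}0&\sigma_j\\ \sigma_j&0\end{pmatrix}$ with the Pauli matrices $\sigma_j$, and $\beta=\begin{pmatrix}1_2&0\\0&-1_2\end{pmatrix}$. Put $\mathbf M^-=\vec\alpha\otimes 1_4-1_4\otimes\vec\alpha$ and $B=2\,\beta\otimes\beta$. Let $\tau$ be the Fourier multiplier on $\mathcal H$ with symbol $\tau(\vec p)=-(\vec\alpha\cdot\vec p\otimes\vec\alpha\cdot\vec p)/|\vec p|^2$, let $P_+=\frac12(1+\tau)$, $\mathcal H_+=P_+\mathcal H$ and $\mathcal D_+=(\mathbb C^{16}\otimes H^1(\mathbb R^3))\cap\mathcal H_+$. For $\kappa>0$ let $V$ and $V^{1/2}$ be the operators of multiplication by $|\vec r|^{-\kappa}$ and $|\vec r|^{-\kappa/2}$ in $\mathcal H$ on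 their maximal domains, let $(|\gamma|V)^{1/2}=|\gamma|^{1/2}V^{1/2}$ for $\gamma\in\mathbb R$, and let $$M_\kappa=2^{-\kappa}\,\frac{\Gamma(\frac34-\frac\kappa2)}{\Gamma(\frac34+\frac\kappa2)}.$$ In the Hilbert space $\mathcal H_+$ consider $A=\mathbf M^-\cdot\hat{\vec p}+BP_++P_+\gamma VP_+$ with domain $\mathcal D_+$. **Lemma.** Let $0<\kappa\le1$ and $|\gamma|M_{\kappa/2}^2<1$. Then $A$ is well-defined on $\mathcal D_+$ and is a bijection from $\mathcal D_+$ onto $\mathcal H_+$, the operator $$(|\gamma|V)^{1/2}P_+A^{-1}P_+(|\gamma|V)^{1/2}$$ has as its natural domain the dense subspace $\mathcal D(V^{1/2})$ of $\mathcal H$, it is bounded on it, and its norm $C$ (the least $c\ge0$ with $\|(|\gamma|V)^{1/2}P_+A^{-1}P_+(|\gamma|V)^{1/2}f\|\le c\,\|f\|$ for all $f\in\mathcal D(V^{1/2})$) satisfies $$C\le\frac{|\gamma|M_{\kappa/2}^2}{2-|\gamma|M_{\kappa/2}^2}<1.$$ -/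

import Mathlib

open MeasureTheory
open scoped Kronecker SchwartzMap

noncomputable section

namespace TwoBodyDirac

/-! ### Partially defined operators -/

section Operators

variable {H : Type*} [NormedAddCommGroup H] [NormedSpace ℂ H]

/-- The natural domain `{x ∈ D(f) | f x ∈ D(g)}` of the product `g f`. -/
def pcompDomain (g f : H →ₗ.[ℂ] H) : Submodule ℂ H where
  carrier := {x | ∃ hx : x ∈ f.domain, f ⟨x, hx⟩ ∈ g.domain}
  add_mem' := by
    rintro x y ⟨hx, hx'⟩ ⟨hy, hy'⟩
    refine ⟨f.domain.add_mem hx hy, ?_⟩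
    have h : f ⟨x + y, f.domain.add_mem hx hy⟩ = f ⟨x, hx⟩ + f ⟨y, hy⟩ :=
      f.map_add ⟨x, hx⟩ ⟨y, hy⟩
    rw [h]
    exact g.domain.add_mem hx' hy'
  zero_mem' := by
    refine ⟨f.domain.zero_mem, ?_⟩
    have h : f ⟨0, f.domain.zero_mem⟩ = 0 := f.map_zero
    rw [h]
    exact g.domain.zero_mem
  smul_mem' := by
    rintro c x ⟨hx, hx'⟩
    refine ⟨f.domain.smul_mem c hx, ?_⟩
    have h : f ⟨c • x, f.domain.smul_mem c hx⟩ = c • f ⟨x, hx⟩ := f.map_smul c ⟨x, hx⟩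
    rw [h]
    exact g.domain.smul_mem c hx'

theorem mem_pcompDomain {g f : H →ₗ.[ℂ] H} {x : H} :
    x ∈ pcompDomain g f ↔ ∃ hx : x ∈ f.domain, f ⟨x, hx⟩ ∈ g.domain := Iff.rfl

/-- The product `g f` of two unbounded operators on its natural domain. -/
def pcomp (g f : H →ₗ.[ℂ] H) : H →ₗ.[ℂ] H where
  domain := pcompDomain g f
  toFun :=
    { toFun := fun x => g ⟨f ⟨x.1, (mem_pcompDomain.mp x.2).1⟩, (mem_pcompDomain.mp x.2).2⟩
      map_add' := by
        intro x y
        rw [← g.map_add]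
        congr 1
        exact Subtype.ext (f.map_add ⟨x.1, (mem_pcompDomain.mp x.2).1⟩
          ⟨y.1, (mem_pcompDomain.mp y.2).1⟩)
      map_smul' := by
        intro c x
        rw [RingHom.id_apply, ← g.map_smul]
        congr 1
        exact Subtype.ext (f.map_smul c ⟨x.1, (mem_pcompDomain.mp x.2).1⟩) }

/-- A bounded, everywhere defined operator as an operator with domain the whole space. -/
def everywhere (T : H →L[ℂ] H) : H →ₗ.[ℂ] H := (T : H →ₗ[ℂ] H).toPMap ⊤

/-- `T` is bounded on its domain. -/
def IsBoundedOp (T : H →ₗ.[ℂ] H) : Prop := ∃ c : ℝ, ∀ x : T.domain, ‖T x‖ ≤ c * ‖x‖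

/-- The operator norm of an operator that is bounded on its domain: the least admissible bound. -/
def opNorm (T : H →ₗ.[ℂ] H) : ℝ := sInf {c : ℝ | 0 ≤ c ∧ ∀ x : T.domain, ‖T x‖ ≤ c * ‖x‖}

end Operators

/-! ### The Hilbert space of the relative coordinate -/

/-- The space `ℝ³` of the relative coordinate (and of the relative momentum). -/
abbrev R3 : Type := EuclideanSpace ℝ (Fin 3)

/-- Index set of the components of a spinor in `ℂ⁴ = ℂ² ⊕ ℂ²`. -/
abbrev Idx4 : Type := Fin 2 ⊕ Fin 2

/-- Index set of the components of a two-particle spinor in `ℂ¹⁶ = ℂ⁴ ⊗ ℂ⁴`. -/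
abbrev Idx16 : Type := Idx4 × Idx4

/-- Two-particle spinors `ℂ¹⁶ = ℂ⁴ ⊗ ℂ⁴`. -/
abbrev Spinor : Type := EuclideanSpace ℂ Idx16

/-- `Hrel = ℂ¹⁶ ⊗ L²(ℝ³) = L²(ℝ³; ℂ¹⁶)`. -/
abbrev Hrel : Type := Lp Spinor 2 (volume : Measure R3)

/-- The unitary Fourier transform on `L²(ℝ³; ℂ¹⁶)`, with kernel `exp(-2πi r·ξ)`. -/
abbrev fourierL2 : Hrel ≃ₗᵢ[ℂ] Hrel := Lp.fourierTransformₗᵢ R3 Spinor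

/-- The maximal domain `{f ∈ L² | m f ∈ L²}` of multiplication by a matrix-valued function `m`. -/
def mulDomain (m : R3 → Spinor →L[ℂ] Spinor) : Submodule ℂ Hrel where
  carrier := {f | MemLp (fun r => m r (f r)) 2 volume}
  add_mem' := by
    intro f g hf hg
    refine (memLp_congr_ae ?_).mp (MemLp.add hf hg)
    filter_upwards [Lp.coeFn_add f g] with r hr
    rw [hr, Pi.add_apply, Pi.add_apply, map_add]
  zero_mem' := by
    refine (memLp_congr_ae ?_).mp (MemLp.zero (ε := Spinor))
    filter_upwards [Lp.coeFn_zero Spinor 2 (volume : Measure R3)] with r hr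
    rw [hr, Pi.zero_apply, map_zero]
  smul_mem' := by
    intro c f hf
    refine (memLp_congr_ae ?_).mp (MemLp.const_smul hf c)
    filter_upwards [Lp.coeFn_smul c f] with r hr
    rw [hr, Pi.smul_apply, Pi.smul_apply, map_smul]

theorem mem_mulDomain {m : R3 → Spinor →L[ℂ] Spinor} {f : Hrel} :
    f ∈ mulDomain m ↔ MemLp (fun r => m r (f r)) 2 volume := Iff.rfl

/-- Multiplication by a matrix-valued function `m`, on its maximal domain. -/
def mulOp (m : R3 → Spinor →L[ℂ] Spinor) : Hrel →ₗ.[ℂ] Hrel where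
  domain := mulDomain m
  toFun :=
    { toFun := fun f => MemLp.toLp (fun r => m r (f.1 r)) (mem_mulDomain.mp f.2)
      map_add' := by
        intro f g
        rw [← MemLp.toLp_add]
        refine MemLp.toLp_congr _ _ ?_
        filter_upwards [Lp.coeFn_add f.1 g.1] with r hr
        rw [Submodule.coe_add, hr, Pi.add_apply, Pi.add_apply, map_add]
      map_smul' := by
        intro c f
        rw [RingHom.id_apply, ← MemLp.toLp_const_smul]
        refine MemLp.toLp_congr _ _ ?_
        filter_upwards [Lp.coeFn_smul c f.1] with r hr
        rw [Submodule.coe_smul, hr, Pi.smul_apply, Pi.smul_apply, map_smul] }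

/-- The Fourier multiplier with matrix-valued symbol `m`, on its maximal domain
`{f ∈ L² | m f̂ ∈ L²}`. -/
def fourierMul (m : R3 → Spinor →L[ℂ] Spinor) : Hrel →ₗ.[ℂ] Hrel where
  domain := (mulDomain m).comap (fourierL2 : Hrel →ₗ[ℂ] Hrel)
  toFun :=
    { toFun := fun f => fourierL2.symm (mulOp m ⟨fourierL2 f.1, Submodule.mem_comap.mp f.2⟩)
      map_add' := by
        intro f g
        rw [← map_add, ← (mulOp m).map_add]
        congr 2
        exact Subtype.ext (map_add fourierL2 f.1 g.1)
      map_smul' := by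
        intro c f
        rw [RingHom.id_apply, ← map_smul, ← (mulOp m).map_smul]
        congr 2
        exact Subtype.ext (map_smul fourierL2 c f.1) }

/-! ### Dirac matrices -/

/-- The Pauli matrices. -/
def sigma : Fin 3 → Matrix (Fin 2) (Fin 2) ℂ :=
  ![!![0, 1; 1, 0], !![0, -Complex.I; Complex.I, 0], !![1, 0; 0, -1]]

/-- The Dirac matrices `α₁, α₂, α₃` in the standard representation. -/
def alpha (j : Fin 3) : Matrix Idx4 Idx4 ℂ := Matrix.fromBlocks 0 (sigma j) (sigma j) 0

/-- The Dirac matrix `β` in the standard representation. -/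
def beta : Matrix Idx4 Idx4 ℂ := Matrix.fromBlocks 1 0 0 (-1)

/-- The matrix `α · p`. -/
def alphaDot (p : R3) : Matrix Idx4 Idx4 ℂ := ∑ j, (p j : ℂ) • alpha j

/-- The matrices `M⁻ⱼ = αⱼ ⊗ 1₄ - 1₄ ⊗ αⱼ`. -/
def Mminus (j : Fin 3) : Matrix Idx16 Idx16 ℂ := alpha j ⊗ₖ 1 - 1 ⊗ₖ alpha j

/-- The matrix `M⁻ · p`. -/
def MminusDot (p : R3) : Matrix Idx16 Idx16 ℂ := ∑ j, (p j : ℂ) • Mminus j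

/-- The matrix `τ(p) = -(α·p ⊗ α·p) / p²`. -/
def tauMatrix (p : R3) : Matrix Idx16 Idx16 ℂ :=
  -((((‖p‖ ^ 2)⁻¹ : ℝ) : ℂ) • (alphaDot p ⊗ₖ alphaDot p))

/-- The matrix `B = 2 β ⊗ β`. -/
def Bmatrix : Matrix Idx16 Idx16 ℂ := (2 : ℂ) • (beta ⊗ₖ beta)

/-- The linear map of `ℂ¹⁶` given by a `16 × 16` matrix. -/
abbrev matMap (M : Matrix Idx16 Idx16 ℂ) : Spinor →L[ℂ] Spinor :=
  Matrix.toEuclideanCLM (𝕜 := ℂ) M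

/-! ### Boundedness of `τ` -/

theorem sigmaDot_sq (p : R3) :
    (∑ j, (p j : ℂ) • sigma j) * (∑ j, (p j : ℂ) • sigma j) = ((‖p‖ ^ 2 : ℝ) : ℂ) • 1 := by
  have hn : ((‖p‖ ^ 2 : ℝ) : ℂ) = (p 0 : ℂ) ^ 2 + (p 1 : ℂ) ^ 2 + (p 2 : ℂ) ^ 2 := by
    rw [EuclideanSpace.real_norm_sq_eq, Fin.sum_univ_three]
    push_cast
    rfl
  rw [hn]
  ext i k
  fin_cases i <;> fin_cases k <;>
    simp [Fin.sum_univ_three, sigma, Matrix.mul_apply, Fin.sum_univ_two] <;>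
    ring_nf <;> simp [Complex.I_sq]

theorem alphaDot_eq (p : R3) : alphaDot p =
    Matrix.fromBlocks 0 (∑ j, (p j : ℂ) • sigma j) (∑ j, (p j : ℂ) • sigma j) 0 := by
  simp [alphaDot, alpha, Fin.sum_univ_three, Matrix.fromBlocks_smul, Matrix.fromBlocks_add]

theorem alphaDot_sq (p : R3) : alphaDot p * alphaDot p = ((‖p‖ ^ 2 : ℝ) : ℂ) • 1 := by
  rw [alphaDot_eq, Matrix.fromBlocks_multiply]
  simp only [zero_mul, mul_zero, zero_add, add_zero, sigmaDot_sq]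
  rw [← Matrix.fromBlocks_one, Matrix.fromBlocks_smul]
  simp

theorem sigma_conjTranspose (j : Fin 3) : (sigma j).conjTranspose = sigma j := by
  ext i k
  fin_cases j <;> fin_cases i <;> fin_cases k <;> simp [sigma, Matrix.conjTranspose_apply]

theorem alphaDot_conjTranspose (p : R3) : (alphaDot p).conjTranspose = alphaDot p := by
  simp [alphaDot, alpha, Matrix.conjTranspose_sum, Matrix.conjTranspose_smul,
    Matrix.fromBlocks_conjTranspose, sigma_conjTranspose]

theorem tauMatrix_conjTranspose (p : R3) : (tauMatrix p).conjTranspose = tauMatrix p := by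
  rw [tauMatrix, Matrix.conjTranspose_neg, Matrix.conjTranspose_smul,
    Matrix.conjTranspose_kronecker, alphaDot_conjTranspose]
  simp

theorem tauMatrix_sq {p : R3} (hp : p ≠ 0) : tauMatrix p * tauMatrix p = 1 := by
  have h : ((‖p‖ ^ 2 : ℝ) : ℂ) ≠ 0 := by
    exact_mod_cast pow_ne_zero 2 (norm_ne_zero_iff.mpr hp)
  rw [tauMatrix, neg_mul_neg, smul_mul_smul_comm, ← Matrix.mul_kronecker_mul, alphaDot_sq,
    Matrix.smul_kronecker, Matrix.kronecker_smul, Matrix.one_kronecker_one, smul_smul, smul_smul,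
    Complex.ofReal_inv]
  field_simp
  simp

theorem norm_tau_apply_le (p : R3) (v : Spinor) : ‖matMap (tauMatrix p) v‖ ≤ ‖v‖ := by
  rcases eq_or_ne p 0 with rfl | hp
  · simp [tauMatrix]
  · have hs : star (matMap (tauMatrix p)) = matMap (tauMatrix p) := by
      rw [matMap, ← map_star, Matrix.star_eq_conjTranspose, tauMatrix_conjTranspose]
    have hm : matMap (tauMatrix p) * matMap (tauMatrix p) = 1 := by
      rw [matMap, ← map_mul, tauMatrix_sq hp, map_one]
    have h1 : ‖matMap (tauMatrix p)‖ * ‖matMap (tauMatrix p)‖ ≤ 1 := by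
      rw [← CStarRing.norm_star_mul_self, hs, hm]
      exact ContinuousLinearMap.norm_id_le
    have h2 : ‖matMap (tauMatrix p)‖ ≤ 1 := by nlinarith [norm_nonneg (matMap (tauMatrix p))]
    simpa using (matMap (tauMatrix p)).le_of_opNorm_le h2 v

theorem measurable_tau_apply {f : R3 → Spinor} (hf : AEStronglyMeasurable f volume) :
    AEStronglyMeasurable (fun p => matMap (tauMatrix p) (f p)) volume := by
  have he : ∀ i k, Measurable fun p : R3 => tauMatrix p i k := by
    intro i k
    simp only [tauMatrix, alphaDot, Matrix.neg_apply, Matrix.smul_apply,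
      Matrix.kroneckerMap_apply, Matrix.sum_apply, smul_eq_mul]
    fun_prop
  have hf' : AEMeasurable f volume := hf.aemeasurable
  refine AEMeasurable.aestronglyMeasurable ?_
  have h : AEMeasurable (fun p : R3 => fun i => ∑ k, tauMatrix p i k * f p k) volume := by
    refine aemeasurable_pi_iff.mpr fun i => ?_
    refine Finset.aemeasurable_fun_sum _ fun k _ => (he i k).aemeasurable.mul ?_
    fun_prop
  exact (PiLp.continuous_toLp 2 _).measurable.comp_aemeasurable h

theorem memLp_tau (f : Hrel) :
    MemLp (fun p => matMap (tauMatrix p) (fourierL2 f p)) 2 volume :=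
  (Lp.memLp (fourierL2 f)).mono (measurable_tau_apply (Lp.memLp (fourierL2 f)).1)
    (Filter.Eventually.of_forall fun p => norm_tau_apply_le p _)

theorem mem_domain_tau (f : Hrel) : f ∈ (fourierMul fun p => matMap (tauMatrix p)).domain :=
  memLp_tau f

/-! ### The projection `P₊`, the potential and the operator `A` -/

/-- The bounded operator `τ`, the Fourier multiplier with symbol `τ(p)`. (The symbol is homogeneous
of degree zero, so that the normalisation of the momentum variable does not matter.) -/
def tau : Hrel →L[ℂ] Hrel :=
  LinearMap.mkContinuous
    { toFun := fun f => fourierMul (fun p => matMap (tauMatrix p)) ⟨f, mem_domain_tau f⟩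
      map_add' := fun f g => (fourierMul fun p => matMap (tauMatrix p)).map_add
        ⟨f, mem_domain_tau f⟩ ⟨g, mem_domain_tau g⟩
      map_smul' := fun c f => (fourierMul fun p => matMap (tauMatrix p)).map_smul c
        ⟨f, mem_domain_tau f⟩ }
    1 (by
      intro f
      change ‖fourierL2.symm (MemLp.toLp (fun p => matMap (tauMatrix p) (fourierL2 f p)) (memLp_tau f))‖ ≤ _
      rw [LinearIsometryEquiv.norm_map, ← LinearIsometryEquiv.norm_map fourierL2 f]
      refine Lp.norm_le_mul_norm_of_ae_le_mul ?_
      filter_upwards [MemLp.coeFn_toLp (memLp_tau f)] with p hp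
      rw [hp, one_mul]
      exact norm_tau_apply_le p _)

/-- `P₊ = (1 + τ) / 2`. -/
def Pplus : Hrel →L[ℂ] Hrel := (2⁻¹ : ℂ) • (ContinuousLinearMap.id ℂ Hrel + tau)

/-- The closed subspace `H₊ = P₊ Hrel`. -/
def Hplus : Submodule ℂ Hrel := LinearMap.range (Pplus : Hrel →ₗ[ℂ] Hrel)

/-- The Sobolev space `ℂ¹⁶ ⊗ H¹(ℝ³)` as a subspace of `Hrel`. -/
def sobolevOne : Submodule ℂ Hrel where
  carrier := {f | TemperedDistribution.MemSobolev 1 2 (f : 𝓢'(R3, Spinor))}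
  add_mem' := by
    intro f g hf hg
    have h := TemperedDistribution.MemSobolev.add hf hg
    rw [← Lp.toTemperedDistributionCLM_apply, ← Lp.toTemperedDistributionCLM_apply,
      ← map_add] at h
    exact h
  zero_mem' := by
    have h := TemperedDistribution.memSobolev_fun_zero R3 Spinor 1 2
    rw [← map_zero (Lp.toTemperedDistributionCLM Spinor (volume : Measure R3) 2)] at h
    exact h
  smul_mem' := by
    intro c f hf
    have h := TemperedDistribution.MemSobolev.smul c hf
    rw [← Lp.toTemperedDistributionCLM_apply, ← map_smul] at h
    exact h

/-- `D₊ = (ℂ¹⁶ ⊗ H¹(ℝ³)) ∩ H₊`. -/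
def Dplus : Submodule ℂ Hrel := sobolevOne ⊓ Hplus

/-- The operator `M⁻ · p̂` with `p̂ = -i∇` on its maximal domain. Under the Fourier transform with
kernel `exp(-2πi r·ξ)` the operator `-i∇` is multiplication by `2πξ`. -/
def MminusP : Hrel →ₗ.[ℂ] Hrel := fourierMul fun ξ => matMap (MminusDot ((2 * Real.pi) • ξ))

/-- The bounded operator of multiplication by the constant matrix `B`. -/
def Bop : Hrel →L[ℂ] Hrel := (matMap Bmatrix).compLpL 2 volume

/-- `V`: multiplication by `|r|^(-κ)` on its maximal domain. -/
def V (κ : ℝ) : Hrel →ₗ.[ℂ] Hrel :=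
  mulOp fun r => ((‖r‖ ^ (-κ) : ℝ) : ℂ) • ContinuousLinearMap.id ℂ Spinor

/-- `V^(1/2)`, the positive square root of the multiplication operator `V`: multiplication by
`(|r|^(-κ))^(1/2)` on its maximal domain. -/
def sqrtV (κ : ℝ) : Hrel →ₗ.[ℂ] Hrel :=
  mulOp fun r => ((Real.sqrt (‖r‖ ^ (-κ)) : ℝ) : ℂ) • ContinuousLinearMap.id ℂ Spinor

/-- `(|γ| V)^(1/2) = |γ|^(1/2) V^(1/2)`, with domain `D(V^(1/2))`. -/
def sqrtAbsV (κ γ : ℝ) : Hrel →ₗ.[ℂ] Hrel := ((Real.sqrt |γ| : ℝ) : ℂ) • sqrtV κ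

/-- `A₀ = M⁻ · p̂ + B P₊`. -/
def A0 : Hrel →ₗ.[ℂ] Hrel := MminusP + everywhere (Bop ∘L Pplus)

/-- `A = A₀ + P₊ γ V P₊` restricted to `D₊`, where the sum and the products carry their natural
domains. It is an operator in the Hilbert space `H₊`. -/
def A (κ γ : ℝ) : Hrel →ₗ.[ℂ] Hrel :=
  (A0 + pcomp (everywhere Pplus) (pcomp ((γ : ℂ) • V κ) (everywhere Pplus))).domRestrict Dplus

/-- The operator `(|γ|V)^(1/2) P₊ A⁻¹ P₊ (|γ|V)^(1/2)` on its natural domain. -/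
def sandwich (κ γ : ℝ) : Hrel →ₗ.[ℂ] Hrel :=
  pcomp (sqrtAbsV κ γ) (pcomp (everywhere Pplus) (pcomp (A κ γ).inverse
    (pcomp (everywhere Pplus) (sqrtAbsV κ γ))))

/-- `M_κ = 2^(-κ) Γ(3/4 - κ/2) / Γ(3/4 + κ/2)`. -/
def Mconst (κ : ℝ) : ℝ :=
  (2 : ℝ) ^ (-κ) * (Real.Gamma (3 / 4 - κ / 2) / Real.Gamma (3 / 4 + κ / 2))

end TwoBodyDirac

end

/-!
The argument has two analytic inputs and is then the Birman–Schwinger scheme for a relatively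
bounded perturbation.

*The free operator.* Write `p = 2πξ`. As `B` anticommutes with `M⁻·p` and
`(M⁻·p)² = 4 p² P₊(p)`, the symbol `M⁻·p + B` commutes with `P₊(p)` and its square on the range of
`P₊(p)` is `4(p² + 1)` (`diracSymbol_mul_self`). Hence `A₀` is a bijection from `D₊` onto `H₊`, with
inverse `freeInverse`, and pointwise in Fourier space both operators are controlled by
`energy p = 2√(p² + 1)` and its reciprocal.

*Herbst's inequality* `‖|r|^(-a) f‖ ≤ M_a ‖|p|^a f‖` (`lintegral_norm_rpow_le`). The weight
`|r|^(-2a)` is a Mellin integral of Gaussians, and multiplication by a Gaussian is convolution with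
a heat kernel in Fourier space. The Schur test with a Riesz weight, itself a Mellin integral of heat
kernels, bounds the resulting form; by the semigroup property of the heat kernels and the Beta
integral the weight is mapped to a multiple of a Riesz weight, and the product of the Gamma factors
is exactly `M_a²`. In this way neither the Fourier transform of `|r|^(-2a)` nor the composition
formula for Riesz potentials is needed.

Since `|p|^κ ≤ energy p / 2` for `0 ≤ κ ≤ 1`, Herbst's inequality gives

* `‖V A₀⁻¹ g‖ ≤ (M_κ / 2) ‖g‖` (`norm_V_le`), and
* `‖V^(1/2) A₀⁻¹ V^(1/2) z‖ ≤ (M_{κ/2}² / 2) ‖z‖` (`norm_sqrtV_freeInverse_sqrtV_le`).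

*Bijectivity.* On `H₊` one has `A A₀⁻¹ = 1 + γ P₊ V A₀⁻¹`, so that a Neumann series inverts `A` once
`|γ| M_κ / 2 < 1`. The hypothesis concerns `M_{κ/2}²` instead; the two are linked by
`M_κ ≤ 2 M_{κ/2}²` (`Mconst_le`), a consequence of the convexity of `log Γ` and of
`Γ(1/4) Γ(3/4) = π√2`.

*The norm bound.* Let `y = A⁻¹ P₊ (|γ|V)^(1/2) x`. Then `V y = V^(1/2) V^(1/2) y`, so `A y = …` reads
`A₀ y = P₊ V^(1/2) z` with `z = |γ|^(1/2) x - γ V^(1/2) y`, and with `q = M_{κ/2}² / 2` the second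
bound gives `‖V^(1/2) y‖ ≤ q (|γ|^(1/2) ‖x‖ + |γ| ‖V^(1/2) y‖)`. Solving for `‖V^(1/2) y‖` yields
`‖(|γ|V)^(1/2) y‖ ≤ |γ| q / (1 - |γ| q) ‖x‖`, which is the asserted bound.
-/

noncomputable section

namespace TwoBodyDirac

open Real Set ENNReal
open scoped FourierTransform

/-! ### Gaussian and Gamma integrals -/

/-- The heat kernel of `ℝ³` in the normalisation `t^(-3/2) exp(-π|p|²/t)`: the Fourier transform of
`exp(-πt|x|²)`. -/
def heat (t : ℝ) (p : R3) : ℝ := t ^ (-(3 / 2) : ℝ) * Real.exp (-(π / t) * ‖p‖ ^ 2)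

theorem heat_nonneg {t : ℝ} (ht : 0 ≤ t) (p : R3) : 0 ≤ heat t p :=
  mul_nonneg (Real.rpow_nonneg ht _) (Real.exp_pos _).le

theorem heat_neg (t : ℝ) (p : R3) : heat t (-p) = heat t p := by
  simp [heat]

theorem integrable_heat {t : ℝ} (ht : 0 < t) : Integrable (heat t) := by
  have h : Integrable fun p : R3 => Real.exp (-(π / t) * ‖p‖ ^ 2) := by
    have := GaussianFourier.integrable_cexp_neg_mul_sq_norm_add (V := R3)
      (b := ((π / t : ℝ) : ℂ)) (by simpa using div_pos pi_pos ht) 0 0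
    refine (this.re).congr (Filter.Eventually.of_forall fun p => ?_)
    have : -((π / t : ℝ) : ℂ) * (‖p‖ : ℂ) ^ 2 + 0 * ((inner ℝ (0 : R3) p : ℝ) : ℂ)
        = ((-(π / t) * ‖p‖ ^ 2 : ℝ) : ℂ) := by push_cast; ring
    simp only [this]
    rw [← Complex.ofReal_exp]
    exact Complex.ofReal_re _
  exact h.const_mul _

theorem lintegral_heat {t : ℝ} (ht : 0 < t) : ∫⁻ p, ENNReal.ofReal (heat t p) = 1 := by
  rw [← ofReal_integral_eq_lintegral_ofReal (integrable_heat ht)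
    (Filter.Eventually.of_forall fun p => heat_nonneg ht.le p)]
  simp only [heat]
  rw [integral_const_mul, GaussianFourier.integral_rexp_neg_mul_sq_norm (div_pos pi_pos ht)]
  have : π / (π / t) = t := by field_simp
  rw [this, finrank_euclideanSpace_fin, ← Real.rpow_add ht]
  norm_num

/-- Completing the square in the product of two heat kernels. -/
theorem heat_mul_heat {t v : ℝ} (ht : 0 < t) (hv : 0 < v) (p q : R3) :
    heat t (p - q) * heat v q = heat (t + v) p * heat (t * v / (t + v)) (q - (v / (t + v)) • p) := by
  have hs : 0 < t + v := add_pos ht hv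
  have h1 : t ^ (-(3 / 2) : ℝ) * v ^ (-(3 / 2) : ℝ)
      = (t + v) ^ (-(3 / 2) : ℝ) * (t * v / (t + v)) ^ (-(3 / 2) : ℝ) := by
    rw [← Real.mul_rpow ht.le hv.le, ← Real.mul_rpow hs.le (by positivity)]
    congr 1
    field_simp
  have h2 : -(π / t) * ‖p - q‖ ^ 2 + -(π / v) * ‖q‖ ^ 2 = -(π / (t + v)) * ‖p‖ ^ 2 +
      -(π / (t * v / (t + v))) * ‖q - (v / (t + v)) • p‖ ^ 2 := by
    rw [norm_sub_sq_real, norm_sub_sq_real, norm_smul, inner_smul_right, real_inner_comm q p,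
      Real.norm_of_nonneg (by positivity)]
    field_simp
    ring
  simp only [heat]
  rw [mul_mul_mul_comm, h1, ← Real.exp_add, h2, Real.exp_add]
  ring

theorem lintegral_heat_mul_heat {t v : ℝ} (ht : 0 < t) (hv : 0 < v) (p : R3) :
    ∫⁻ q, ENNReal.ofReal (heat t (p - q)) * ENNReal.ofReal (heat v q)
      = ENNReal.ofReal (heat (t + v) p) := by
  have hs : 0 < t + v := add_pos ht hv
  simp_rw [← ENNReal.ofReal_mul (heat_nonneg ht.le _), heat_mul_heat ht hv,
    ENNReal.ofReal_mul (heat_nonneg hs.le _)]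
  rw [lintegral_const_mul' _ _ ENNReal.ofReal_ne_top,
    lintegral_sub_right_eq_self (fun q => ENNReal.ofReal (heat (t * v / (t + v)) q)),
    lintegral_heat (by positivity), mul_one]

theorem lintegral_rpow_mul_exp_neg_mul {a r : ℝ} (ha : 0 < a) (hr : 0 < r) :
    ∫⁻ t in Ioi (0 : ℝ), ENNReal.ofReal (t ^ (a - 1) * Real.exp (-(r * t)))
      = ENNReal.ofReal ((1 / r) ^ a * Real.Gamma a) := by
  rw [← Real.integral_rpow_mul_exp_neg_mul_Ioi ha hr]
  refine (ofReal_integral_eq_lintegral_ofReal ?_ ?_).symm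
  · have := integrableOn_rpow_mul_exp_neg_mul_rpow (p := 1) (s := a - 1) (b := r)
      (by linarith) one_pos hr
    refine this.congr_fun (fun t _ => ?_) measurableSet_Ioi
    simp
  · filter_upwards [ae_restrict_mem measurableSet_Ioi] with t ht
    have : 0 < t := ht
    positivity

/-- The substitution `t ↦ 1/t` in an integral over the positive half line. -/
theorem lintegral_Ioi_comp_inv (F : ℝ → ℝ≥0∞) :
    ∫⁻ t in Ioi (0 : ℝ), F t = ∫⁻ u in Ioi (0 : ℝ), ENNReal.ofReal (u ^ (-2 : ℝ)) * F u⁻¹ := by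
  have himg : (fun u : ℝ => u⁻¹) '' Ioi 0 = Ioi 0 := by
    ext x
    constructor
    · rintro ⟨u, hu, rfl⟩
      exact mem_Ioi.mpr (inv_pos.mpr (mem_Ioi.mp hu))
    · intro hx
      exact ⟨x⁻¹, mem_Ioi.mpr (inv_pos.mpr (mem_Ioi.mp hx)), inv_inv x⟩
  have h := lintegral_image_eq_lintegral_abs_deriv_mul (s := Ioi (0 : ℝ)) (f := fun u => u⁻¹)
    (f' := fun u => -(u ^ 2)⁻¹) measurableSet_Ioi
    (fun u hu => (hasDerivAt_inv (ne_of_gt hu)).hasDerivWithinAt)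
    (inv_injective.injOn) F
  rw [himg] at h
  rw [h]
  refine setLIntegral_congr_fun measurableSet_Ioi fun u hu => ?_
  have hu' : (0 : ℝ) < u := hu
  simp only [abs_neg]
  rw [abs_of_pos (by positivity), Real.rpow_neg hu'.le]
  norm_cast

/-- The Mellin transform of the heat kernel in the time variable. -/
theorem lintegral_rpow_mul_heat {b : ℝ} (hb : b < 3 / 2) {q : R3} (hq : q ≠ 0) :
    ∫⁻ v in Ioi (0 : ℝ), ENNReal.ofReal (v ^ (b - 1)) * ENNReal.ofReal (heat v q)
      = ENNReal.ofReal ((1 / (π * ‖q‖ ^ 2)) ^ (3 / 2 - b) * Real.Gamma (3 / 2 - b)) := by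
  have hq' : 0 < ‖q‖ := norm_pos_iff.mpr hq
  rw [← lintegral_rpow_mul_exp_neg_mul (by linarith) (by positivity), lintegral_Ioi_comp_inv]
  refine setLIntegral_congr_fun measurableSet_Ioi fun u hu => ?_
  have hu' : (0 : ℝ) < u := hu
  simp only [heat]
  rw [← ENNReal.ofReal_mul (by positivity), ← ENNReal.ofReal_mul (by positivity)]
  congr 1
  rw [Real.inv_rpow hu'.le, Real.inv_rpow hu'.le, ← Real.rpow_neg hu'.le, ← Real.rpow_neg hu'.le,
    ← mul_assoc, ← mul_assoc, ← Real.rpow_add hu', ← Real.rpow_add hu']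
  congr 2
  · ring
  · rw [div_inv_eq_mul]; ring

/-- The Beta integral over `(0, T)`. -/
theorem lintegral_rpow_mul_rpow_sub {a b T : ℝ} (ha : 0 < a) (hb : 0 < b) (hT : 0 < T) :
    ∫⁻ t in Ioo 0 T, ENNReal.ofReal (t ^ (a - 1)) * ENNReal.ofReal ((T - t) ^ (b - 1))
      = ENNReal.ofReal (ProbabilityTheory.beta a b) * ENNReal.ofReal (T ^ (a + b - 1)) := by
  have hB := ProbabilityTheory.beta_pos ha hb
  have himg : (fun x : ℝ => T * x) '' Ioo 0 1 = Ioo 0 T := by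
    ext x
    constructor
    · rintro ⟨u, hu, rfl⟩
      exact ⟨mul_pos hT hu.1, by nlinarith [hu.2]⟩
    · intro hx
      exact ⟨x / T, ⟨div_pos hx.1 hT, (div_lt_one hT).mpr hx.2⟩, by field_simp⟩
  have h := lintegral_image_eq_lintegral_abs_deriv_mul (s := Ioo (0 : ℝ) 1) (f := fun x => T * x)
    (f' := fun _ => T) measurableSet_Ioo
    (fun u _ => by simpa using ((hasDerivAt_id u).const_mul T).hasDerivWithinAt)
    ((mul_right_injective₀ hT.ne').injOn)
    (fun t => ENNReal.ofReal (t ^ (a - 1)) * ENNReal.ofReal ((T - t) ^ (b - 1)))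
  rw [himg] at h
  have h1 := ProbabilityTheory.lintegral_betaPDF_eq_one ha hb
  rw [ProbabilityTheory.lintegral_betaPDF] at h1
  rw [h, ← mul_one (ENNReal.ofReal (ProbabilityTheory.beta a b) * _), ← h1,
    ← lintegral_const_mul' _ _ (ENNReal.mul_ne_top ENNReal.ofReal_ne_top ENNReal.ofReal_ne_top)]
  refine setLIntegral_congr_fun measurableSet_Ioo fun x hx => ?_
  have hx0 : 0 < x := hx.1
  have hx1 : 0 < 1 - x := by linarith [hx.2]
  rw [abs_of_pos hT, ← ENNReal.ofReal_mul (by positivity), ← ENNReal.ofReal_mul (by positivity),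
    ← ENNReal.ofReal_mul (by positivity), ← ENNReal.ofReal_mul (by positivity)]
  congr 1
  have e1 : T - T * x = T * (1 - x) := by ring
  have e2 : T ^ (a + b - 1) = T * (T ^ (a - 1) * T ^ (b - 1)) := by
    nth_rewrite 2 [← Real.rpow_one T]
    rw [← Real.rpow_add hT, ← Real.rpow_add hT]
    congr 1; ring
  rw [e1, Real.mul_rpow hT.le hx0.le, Real.mul_rpow hT.le hx1.le, e2]
  field_simp

/-- The convolution of `t^(a-1)` and `v^(b-1)` on the half line, paired with `F`. -/
theorem lintegral_rpow_conv {a b : ℝ} (ha : 0 < a) (hb : 0 < b) {F : ℝ → ℝ≥0∞}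
    (hF : Measurable F) :
    ∫⁻ t in Ioi (0 : ℝ), ∫⁻ v in Ioi (0 : ℝ),
      ENNReal.ofReal (t ^ (a - 1)) * ENNReal.ofReal (v ^ (b - 1)) * F (t + v)
    = ENNReal.ofReal (ProbabilityTheory.beta a b) *
      ∫⁻ T in Ioi (0 : ℝ), ENNReal.ofReal (T ^ (a + b - 1)) * F T := by
  let k : ℝ → ℝ → ℝ≥0∞ := fun t T =>
    (Ioi (0 : ℝ)).indicator (fun t => ENNReal.ofReal (t ^ (a - 1))) t *
    (Ioi (0 : ℝ)).indicator (fun v => ENNReal.ofReal (v ^ (b - 1))) (T - t) * F T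
  have hk : Measurable (Function.uncurry k) := by
    have m1 : Measurable ((Ioi (0 : ℝ)).indicator fun t : ℝ => ENNReal.ofReal (t ^ (a - 1))) :=
      Measurable.indicator (by fun_prop) measurableSet_Ioi
    have m2 : Measurable ((Ioi (0 : ℝ)).indicator fun t : ℝ => ENNReal.ofReal (t ^ (b - 1))) :=
      Measurable.indicator (by fun_prop) measurableSet_Ioi
    exact ((m1.comp measurable_fst).mul (m2.comp (measurable_snd.sub measurable_fst))).mul
      (hF.comp measurable_snd)
  calc _ = ∫⁻ t, ∫⁻ T, k t T := by
        rw [← lintegral_indicator measurableSet_Ioi]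
        refine lintegral_congr fun t => ?_
        rw [← lintegral_add_right_eq_self (fun T => k t T) t]
        by_cases ht : t ∈ Ioi (0 : ℝ)
        · rw [indicator_of_mem ht, ← lintegral_indicator measurableSet_Ioi]
          refine lintegral_congr fun v => ?_
          by_cases hv : v ∈ Ioi (0 : ℝ)
          · simp [k, indicator_of_mem ht, indicator_of_mem hv, add_comm]
          · simp [k, indicator_of_notMem hv]
        · simp [k, indicator_of_notMem ht]
    _ = ∫⁻ T, ∫⁻ t, k t T := lintegral_lintegral_swap hk.aemeasurable
    _ = _ := by
        rw [← lintegral_const_mul' _ _ ENNReal.ofReal_ne_top, ← lintegral_indicator measurableSet_Ioi]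
        refine lintegral_congr fun T => ?_
        by_cases hT : T ∈ Ioi (0 : ℝ)
        · rw [indicator_of_mem hT, ← mul_assoc, ← lintegral_rpow_mul_rpow_sub ha hb hT,
            ← lintegral_mul_const _ (by fun_prop), ← lintegral_indicator measurableSet_Ioo]
          refine lintegral_congr fun t => ?_
          by_cases h0 : 0 < t
          · by_cases h1 : t < T
            · rw [indicator_of_mem (show t ∈ Ioo 0 T from ⟨h0, h1⟩)]
              simp only [k]
              rw [indicator_of_mem (mem_Ioi.mpr h0), indicator_of_mem (mem_Ioi.mpr (sub_pos.mpr h1))]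
            · rw [indicator_of_notMem (fun h => h1 h.2)]
              simp only [k]
              rw [indicator_of_notMem (s := Ioi (0 : ℝ)) (a := T - t) (by simpa using h1)]
              simp
          · rw [indicator_of_notMem (fun h => h0 h.1)]
            simp only [k]
            rw [indicator_of_notMem (s := Ioi (0 : ℝ)) (a := t) (by simpa using h0)]
            simp
        · rw [indicator_of_notMem hT]
          refine (lintegral_congr fun t => ?_).trans lintegral_zero
          by_cases h0 : t ∈ Ioi (0 : ℝ)
          · simp only [k]
            have h0' := mem_Ioi.mp h0
            rw [indicator_of_notMem (s := Ioi (0 : ℝ)) (a := T - t)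
              (by simp only [mem_Ioi, not_lt] at hT ⊢; linarith)]
            simp
          · simp [k, indicator_of_notMem h0]

/-! ### A convexity inequality for the constants -/

theorem Mconst_pos {κ : ℝ} (h0 : 0 ≤ κ) (h1 : κ < 3 / 2) : 0 < Mconst κ :=
  mul_pos (by positivity) (div_pos (Real.Gamma_pos_of_pos (by linarith))
    (Real.Gamma_pos_of_pos (by linarith)))

/-- Second differences with right end `3/4` of the convex function `log Γ` grow with the step, and at
the step `1/4` the reflection formula gives `log √2`. -/
theorem Gamma_mul_Gamma_le {x : ℝ} (h0 : 0 ≤ x) (h1 : x ≤ 1 / 4) :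
    Real.Gamma (3 / 4) * Real.Gamma (3 / 4 - 2 * x) ≤ 2 * Real.Gamma (3 / 4 - x) ^ 2 := by
  set u : ℝ → ℝ := Real.log ∘ Real.Gamma with hu
  have hc : ConvexOn ℝ (Ioi 0) u := Real.convexOn_log_Gamma
  have hd : 0 < 1 - 2 * x := by linarith
  have m1 : (1 / 4 : ℝ) ∈ Ioi (0 : ℝ) := mem_Ioi.mpr (by norm_num)
  have m2 : 3 / 4 - x ∈ Ioi (0 : ℝ) := mem_Ioi.mpr (by linarith)
  -- both `3/4 - 2x` and `1/2` lie between `1/4` and `3/4 - x`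
  have c1 := hc.2 m1 m2 (show 0 ≤ 2 * x / (1 - 2 * x) by positivity)
    (show 0 ≤ (1 - 4 * x) / (1 - 2 * x) from div_nonneg (by linarith) hd.le)
    (by field_simp; ring)
  have c2 := hc.2 m1 m2 (show 0 ≤ (1 / 2 - 2 * x) / (1 - 2 * x) from div_nonneg (by linarith) hd.le)
    (show 0 ≤ (1 / 2) / (1 - 2 * x) by positivity) (by field_simp; ring)
  have e1 : (2 * x / (1 - 2 * x)) • (1 / 4 : ℝ) + ((1 - 4 * x) / (1 - 2 * x)) • (3 / 4 - x)
      = 3 / 4 - 2 * x := by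
    simp only [smul_eq_mul]; field_simp; ring
  have e2 : ((1 / 2 - 2 * x) / (1 - 2 * x)) • (1 / 4 : ℝ) + ((1 / 2) / (1 - 2 * x)) • (3 / 4 - x)
      = 1 / 2 := by
    simp only [smul_eq_mul]; field_simp; ring
  rw [e1] at c1
  rw [e2] at c2
  have key : u (3 / 4 - 2 * x) + (u (1 / 2) + u (1 / 2)) ≤
      u (1 / 4) + (u (3 / 4 - x) + u (3 / 4 - x)) := by
    have e3 : 2 * x / (1 - 2 * x) * u (1 / 4) + (1 - 4 * x) / (1 - 2 * x) * u (3 / 4 - x)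
        + 2 * ((1 / 2 - 2 * x) / (1 - 2 * x) * u (1 / 4) + (1 / 2) / (1 - 2 * x) * u (3 / 4 - x))
        = u (1 / 4) + 2 * u (3 / 4 - x) := by field_simp; ring
    simp only [smul_eq_mul] at c1 c2
    linarith
  have p1 : 0 < Real.Gamma (3 / 4) := Real.Gamma_pos_of_pos (by norm_num)
  have p2 : 0 < Real.Gamma (3 / 4 - 2 * x) := Real.Gamma_pos_of_pos (by linarith)
  have p3 : 0 < Real.Gamma (3 / 4 - x) := Real.Gamma_pos_of_pos (by linarith)
  have p4 : 0 < Real.Gamma (1 / 4) := Real.Gamma_pos_of_pos (by norm_num)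
  have hr : Real.Gamma (1 / 4) * Real.Gamma (3 / 4) = π * √2 := by
    have := Real.Gamma_mul_Gamma_one_sub (1 / 4)
    rw [show π * (1 / 4) = π / 4 by ring, Real.sin_pi_div_four] at this
    norm_num at this ⊢
    rw [this, div_div_eq_mul_div, div_eq_iff (by positivity), mul_assoc,
      Real.mul_self_sqrt (by norm_num)]
  have hm : Real.Gamma (3 / 4 - 2 * x) * π ≤ Real.Gamma (1 / 4) * Real.Gamma (3 / 4 - x) ^ 2 := by
    have := Real.exp_le_exp.mpr key
    simp only [hu, Function.comp_apply, Real.exp_add, Real.exp_log p2, Real.exp_log p3,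
      Real.exp_log p4, Real.Gamma_one_half_eq, Real.exp_log (Real.sqrt_pos.mpr pi_pos),
      Real.mul_self_sqrt pi_pos.le] at this
    rwa [← sq] at this
  have h2 : √2 ≤ 2 := by
    rw [Real.sqrt_le_left (by norm_num)]; norm_num
  refine le_of_mul_le_mul_right ?_ pi_pos
  calc _ = Real.Gamma (3 / 4) * (Real.Gamma (3 / 4 - 2 * x) * π) := by ring
    _ ≤ Real.Gamma (3 / 4) * (Real.Gamma (1 / 4) * Real.Gamma (3 / 4 - x) ^ 2) := by gcongr
    _ = (Real.Gamma (1 / 4) * Real.Gamma (3 / 4)) * Real.Gamma (3 / 4 - x) ^ 2 := by ring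
    _ = √2 * Real.Gamma (3 / 4 - x) ^ 2 * π := by rw [hr]; ring
    _ ≤ _ := by gcongr

/-- Midpoint convexity of `log Γ`. -/
theorem Gamma_sq_le {x : ℝ} (h0 : 0 ≤ x) :
    Real.Gamma (3 / 4 + x) ^ 2 ≤ Real.Gamma (3 / 4) * Real.Gamma (3 / 4 + 2 * x) := by
  have hc := Real.convexOn_log_Gamma.2 (show (3 / 4 : ℝ) ∈ Ioi 0 from mem_Ioi.mpr (by norm_num))
    (show 3 / 4 + 2 * x ∈ Ioi 0 from mem_Ioi.mpr (by linarith))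
    (show (0 : ℝ) ≤ 1 / 2 by norm_num) (show (0 : ℝ) ≤ 1 / 2 by norm_num) (by norm_num)
  have e : (1 / 2 : ℝ) • (3 / 4 : ℝ) + (1 / 2 : ℝ) • (3 / 4 + 2 * x) = 3 / 4 + x := by
    simp only [smul_eq_mul]; ring
  have p1 : 0 < Real.Gamma (3 / 4) := Real.Gamma_pos_of_pos (by norm_num)
  have p2 : 0 < Real.Gamma (3 / 4 + 2 * x) := Real.Gamma_pos_of_pos (by linarith)
  have p3 : 0 < Real.Gamma (3 / 4 + x) := Real.Gamma_pos_of_pos (by linarith)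
  rw [e] at hc
  simp only [Function.comp_apply, smul_eq_mul] at hc
  have h := Real.exp_le_exp.mpr (show Real.log (Real.Gamma (3 / 4 + x)) +
    Real.log (Real.Gamma (3 / 4 + x)) ≤ Real.log (Real.Gamma (3 / 4)) +
    Real.log (Real.Gamma (3 / 4 + 2 * x)) by linarith)
  rw [Real.exp_add, Real.exp_add, Real.exp_log p1, Real.exp_log p2, Real.exp_log p3, ← sq] at h
  exact h

/-- The form bound `|γ| M_{κ/2}² < 1` implies an operator bound `|γ| M_κ < 2`. -/
theorem Mconst_le {κ : ℝ} (h0 : 0 ≤ κ) (h1 : κ ≤ 1) : Mconst κ ≤ 2 * Mconst (κ / 2) ^ 2 := by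
  have g1 := Gamma_mul_Gamma_le (x := κ / 4) (by linarith) (by linarith)
  have g2 := Gamma_sq_le (x := κ / 4) (by linarith)
  have p1 : 0 < Real.Gamma (3 / 4) := Real.Gamma_pos_of_pos (by norm_num)
  have p2 : 0 < Real.Gamma (3 / 4 + κ / 2) := Real.Gamma_pos_of_pos (by linarith)
  have p3 : 0 < Real.Gamma (3 / 4 + κ / 4) := Real.Gamma_pos_of_pos (by linarith)
  have p4 : 0 < Real.Gamma (3 / 4 - κ / 2) := Real.Gamma_pos_of_pos (by linarith)
  rw [show 2 * (κ / 4) = κ / 2 by ring] at g1 g2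
  have e : ((2 : ℝ) ^ (-(κ / 2))) ^ 2 = 2 ^ (-κ) := by
    rw [← Real.rpow_natCast, ← Real.rpow_mul (by norm_num)]
    congr 1; push_cast; ring
  unfold Mconst
  rw [mul_pow, e, div_pow, show κ / 2 / 2 = κ / 4 by ring, mul_left_comm]
  refine mul_le_mul_of_nonneg_left ?_ (by positivity)
  rw [← mul_div_assoc, div_le_div_iff₀ p2 (by positivity)]
  refine le_of_mul_le_mul_left ?_ p1
  calc Real.Gamma (3 / 4) * (Real.Gamma (3 / 4 - κ / 2) * Real.Gamma (3 / 4 + κ / 4) ^ 2)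
      = (Real.Gamma (3 / 4) * Real.Gamma (3 / 4 - κ / 2)) * Real.Gamma (3 / 4 + κ / 4) ^ 2 := by ring
    _ ≤ (2 * Real.Gamma (3 / 4 - κ / 4) ^ 2) *
        (Real.Gamma (3 / 4) * Real.Gamma (3 / 4 + κ / 2)) := by gcongr
    _ = _ := by ring

/-! ### Gaussian multiplication in Fourier space -/

theorem lintegral_enorm_sq (f : Hrel) : ∫⁻ x, ‖f x‖ₑ ^ 2 = ‖f‖ₑ ^ 2 := by
  rw [Lp.enorm_def, eLpNorm_eq_lintegral_rpow_enorm_toReal (by norm_num) (by norm_num)]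
  simp only [ENNReal.toReal_ofNat, one_div, ENNReal.rpow_ofNat]
  rw [← ENNReal.rpow_natCast, ← ENNReal.rpow_mul]
  norm_num

theorem fourier_modulated_gaussian {t : ℝ} (ht : 0 < t) (p q : R3) :
    𝓕 (fun x : R3 => Complex.exp (-((π * t : ℝ) : ℂ) * ‖x‖ ^ 2 +
      2 * π * Complex.I * (inner ℝ p x : ℝ))) q = (heat t (p - q) : ℂ) := by
  have hb : 0 < (((π * t : ℝ) : ℂ)).re := by simpa using mul_pos pi_pos ht
  rw [fourier_gaussian_innerProductSpace' hb]
  have hpi : (π : ℂ) ≠ 0 := by exact_mod_cast pi_ne_zero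
  have htc : (t : ℂ) ≠ 0 := by exact_mod_cast ht.ne'
  have e1 : ((π : ℂ) / ((π * t : ℝ) : ℂ)) = ((t⁻¹ : ℝ) : ℂ) := by
    push_cast; field_simp
  have e2 : ((Module.finrank ℝ R3 : ℕ) / 2 : ℂ) = ((3 / 2 : ℝ) : ℂ) := by
    rw [finrank_euclideanSpace_fin]; push_cast; ring
  have e3 : (-(π : ℂ) ^ 2 * (‖p - q‖ : ℂ) ^ 2 / ((π * t : ℝ) : ℂ))
      = ((-(π / t) * ‖p - q‖ ^ 2 : ℝ) : ℂ) := by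
    push_cast; field_simp
  rw [e1, e2, e3, ← Complex.ofReal_exp, ← Complex.ofReal_cpow (by positivity), heat,
    Complex.ofReal_mul, Real.inv_rpow ht.le, Real.rpow_neg ht.le]

theorem integrable_gaussian {t : ℝ} (ht : 0 < t) :
    Integrable fun x : R3 => Real.exp (-(π * t) * ‖x‖ ^ 2) := by
  have h := (integrable_heat (t := t⁻¹) (by positivity)).const_mul ((t⁻¹ ^ (-(3 / 2) : ℝ))⁻¹)
  refine h.congr (Filter.Eventually.of_forall fun x => ?_)
  simp only [heat]
  rw [← mul_assoc, inv_mul_cancel₀ (by positivity), one_mul, div_inv_eq_mul]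

/-- The Gaussian form of a Fourier transform `𝓕 k` is at most the heat kernel form of `|k|`; this is
Parseval's identity for `𝓕 k` and `exp(-πt|x|²) 𝓕 k`, followed by the triangle inequality. -/
theorem lintegral_gaussian_fourier_le {t : ℝ} (ht : 0 < t) {k : R3 → Spinor} (hk : Integrable k) :
    ∫⁻ x, ENNReal.ofReal (Real.exp (-(π * t) * ‖x‖ ^ 2)) * ‖𝓕 k x‖ₑ ^ 2 ≤
      ∫⁻ p, ∫⁻ q, ENNReal.ofReal (heat t (p - q)) * ‖k p‖ₑ * ‖k q‖ₑ := by
  have hcont : Continuous (𝓕 k) :=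
    VectorFourier.fourierIntegral_continuous Real.continuous_fourierChar
      (by exact continuous_inner) hk
  have hbd : ∀ x, ‖𝓕 k x‖ ≤ ∫ y, ‖k y‖ := fun x =>
    VectorFourier.norm_fourierIntegral_le_integral_norm _ _ _ _ _
  have hG := integrable_gaussian ht
  set G : R3 → ℝ := fun x => Real.exp (-(π * t) * ‖x‖ ^ 2) with hGdef
  have hg : Integrable fun x => (G x : ℂ) • 𝓕 k x := by
    refine (hG.ofReal (𝕜 := ℂ)).smul_bdd (∫ y, ‖k y‖)
      hcont.aestronglyMeasurable (Filter.Eventually.of_forall hbd)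
  have hinv : ∀ p, 𝓕⁻ (fun x => (G x : ℂ) • 𝓕 k x) p = ∫ q, (heat t (p - q) : ℂ) • k q := by
    intro p
    rw [Real.fourierInv_eq]
    have hh : Integrable (fun x : R3 => Complex.exp (-((π * t : ℝ) : ℂ) * ‖x‖ ^ 2 +
        2 * π * Complex.I * (inner ℝ p x : ℝ))) :=
      GaussianFourier.integrable_cexp_neg_mul_sq_norm_add
        (by simpa using mul_pos pi_pos ht) (2 * π * Complex.I) p
    have key := VectorFourier.integral_bilin_fourierIntegral_eq_flip (L := innerₗ R3)
      (μ := volume) (ν := volume)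
      (ContinuousLinearMap.lsmul ℂ ℂ : ℂ →L[ℂ] Spinor →L[ℂ] Spinor).flip
      Real.continuous_fourierChar (by exact continuous_inner) hk hh
    rw [flip_innerₗ] at key
    convert! key using 1
    · refine integral_congr_ae (Filter.Eventually.of_forall fun x => ?_)
      simp only [ContinuousLinearMap.flip_apply, ContinuousLinearMap.lsmul_apply]
      rw [Circle.smul_def, smul_smul]
      congr 1
      rw [Real.fourierChar_apply, Complex.exp_add, mul_comm, hGdef]
      push_cast
      rw [real_inner_comm]
      congr 2
      ring
    · refine integral_congr_ae (Filter.Eventually.of_forall fun q => ?_)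
      have := fourier_modulated_gaussian ht p q
      simp only [ContinuousLinearMap.flip_apply, ContinuousLinearMap.lsmul_apply]
      rw [← this]
      rfl
  have key := VectorFourier.integral_sesq_fourierIntegral_eq_neg_flip (L := innerₗ R3)
      (μ := volume) (ν := volume) (innerSL ℂ : Spinor →L⋆[ℂ] Spinor →L[ℂ] ℂ)
      Real.continuous_fourierChar (by exact continuous_inner) hk hg
  have hL : ∫ x, innerSL ℂ (𝓕 k x) ((G x : ℂ) • 𝓕 k x) = ((∫ x, G x * ‖𝓕 k x‖ ^ 2 : ℝ) : ℂ) := by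
    rw [← integral_complex_ofReal]
    refine integral_congr_ae (Filter.Eventually.of_forall fun x => ?_)
    simp only [innerSL_apply_apply, inner_smul_right, inner_self_eq_norm_sq_to_K]
    push_cast
    rfl
  have hint : Integrable fun x => G x * ‖𝓕 k x‖ ^ 2 := by
    refine hG.mul_bdd (c := (∫ y, ‖k y‖) ^ 2) (by fun_prop)
      (Filter.Eventually.of_forall fun x => ?_)
    rw [norm_pow, norm_norm]
    exact pow_le_pow_left₀ (norm_nonneg _) (hbd x) 2
  have hpos : 0 ≤ ∫ x, G x * ‖𝓕 k x‖ ^ 2 :=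
    integral_nonneg fun x => mul_nonneg (Real.exp_pos _).le (by positivity)
  calc _ = ENNReal.ofReal (∫ x, G x * ‖𝓕 k x‖ ^ 2) := by
        rw [ofReal_integral_eq_lintegral_ofReal hint
          (Filter.Eventually.of_forall fun x => mul_nonneg (Real.exp_pos _).le (by positivity))]
        refine lintegral_congr fun x => ?_
        rw [ENNReal.ofReal_mul (Real.exp_pos _).le, ENNReal.ofReal_pow (norm_nonneg _), ofReal_norm]
    _ = ‖∫ x, innerSL ℂ (𝓕 k x) ((G x : ℂ) • 𝓕 k x)‖ₑ := by
        rw [hL, ← ofReal_norm, Complex.norm_real, Real.norm_of_nonneg hpos]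
    _ = ‖∫ p, innerSL ℂ (k p) (𝓕⁻ (fun x => (G x : ℂ) • 𝓕 k x) p)‖ₑ := by
        rw [flip_innerₗ] at key
        exact congrArg _ key
    _ ≤ ∫⁻ p, ‖innerSL ℂ (k p) (𝓕⁻ (fun x => (G x : ℂ) • 𝓕 k x) p)‖ₑ :=
        enorm_integral_le_lintegral_enorm _
    _ ≤ _ := by
        refine lintegral_mono fun p => ?_
        rw [innerSL_apply_apply, hinv]
        calc _ ≤ ‖k p‖ₑ * ‖∫ q, (heat t (p - q) : ℂ) • k q‖ₑ := by
              simp only [← ofReal_norm]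
              rw [← ENNReal.ofReal_mul (norm_nonneg _)]
              exact ENNReal.ofReal_le_ofReal (norm_inner_le_norm _ _)
          _ ≤ ‖k p‖ₑ * ∫⁻ q, ‖(heat t (p - q) : ℂ) • k q‖ₑ := by
              gcongr
              exact enorm_integral_le_lintegral_enorm _
          _ = _ := by
              rw [← lintegral_const_mul' _ _ enorm_ne_top]
              refine lintegral_congr fun q => ?_
              rw [enorm_smul, ← ofReal_norm (heat t (p - q) : ℂ), Complex.norm_real,
                Real.norm_of_nonneg (heat_nonneg ht.le _)]
              ring

theorem lintegral_heat_sub_left {t : ℝ} (ht : 0 < t) (p : R3) :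
    ∫⁻ q, ENNReal.ofReal (heat t (p - q)) = 1 := by
  rw [lintegral_sub_left_eq_self (fun q => ENNReal.ofReal (heat t q)), lintegral_heat ht]

theorem measurable_heat_sub (t : ℝ) :
    Measurable fun x : R3 × R3 => ENNReal.ofReal (heat t (x.1 - x.2)) := by
  unfold heat
  fun_prop

theorem lintegral_lintegral_heat_mul_left {t : ℝ} (ht : 0 < t) (E : R3 → ℝ≥0∞) :
    ∫⁻ p, ∫⁻ q, ENNReal.ofReal (heat t (p - q)) * E p = ∫⁻ p, E p := by
  refine lintegral_congr fun p => ?_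
  rw [lintegral_mul_const _ (by unfold heat; fun_prop), lintegral_heat_sub_left ht, one_mul]

theorem lintegral_lintegral_heat_swap (t : ℝ) {K : R3 → R3 → ℝ≥0∞}
    (hK : Measurable (Function.uncurry K)) :
    ∫⁻ p, ∫⁻ q, ENNReal.ofReal (heat t (p - q)) * K p q =
      ∫⁻ p, ∫⁻ q, ENNReal.ofReal (heat t (p - q)) * K q p := by
  rw [lintegral_lintegral_swap ((measurable_heat_sub t).mul hK).aemeasurable]
  refine lintegral_congr fun p => lintegral_congr fun q => ?_
  rw [← heat_neg, neg_sub]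

theorem measurable_enorm_Lp (f : Hrel) : Measurable fun x => ‖f x‖ₑ :=
  (Lp.stronglyMeasurable f).measurable.enorm

/-- A perturbation estimate for squares, with `δ` to be chosen small. -/
theorem enorm_sq_le (v w : Spinor) {δ : NNReal} (hδ : δ ≠ 0) :
    ‖v‖ₑ ^ 2 ≤ (1 + δ) * ‖w‖ₑ ^ 2 + (1 + (δ⁻¹ : NNReal)) * ‖v - w‖ₑ ^ 2 := by
  simp only [enorm_eq_nnnorm]
  norm_cast
  rw [← NNReal.coe_le_coe]
  push_cast
  have h1 : ‖v‖ ≤ ‖w‖ + ‖v - w‖ := by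
    calc ‖v‖ = ‖w + (v - w)‖ := by congr 1; abel
      _ ≤ _ := norm_add_le _ _
  have hd : (0 : ℝ) < δ := by positivity
  have h2 : 0 ≤ (δ * ‖w‖ - ‖v - w‖) ^ 2 * (δ : ℝ)⁻¹ := by positivity
  have h3 : (δ * ‖w‖ - ‖v - w‖) ^ 2 * (δ : ℝ)⁻¹
      = δ * ‖w‖ ^ 2 - 2 * ‖w‖ * ‖v - w‖ + (δ : ℝ)⁻¹ * ‖v - w‖ ^ 2 := by
    field_simp; ring
  have h4 : ‖v‖ ^ 2 ≤ (‖w‖ + ‖v - w‖) ^ 2 := pow_le_pow_left₀ (norm_nonneg _) h1 2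
  nlinarith

theorem enorm_mul_enorm_le (v v' w w' : Spinor) {δ : NNReal} (hδ : δ ≠ 0) :
    ‖w‖ₑ * ‖w'‖ₑ ≤ ‖v‖ₑ * ‖v'‖ₑ + ((δ * ‖v‖ₑ ^ 2 + (1 + (δ⁻¹ : NNReal)) * ‖w - v‖ₑ ^ 2) +
      (δ * ‖v'‖ₑ ^ 2 + (1 + (δ⁻¹ : NNReal)) * ‖w' - v'‖ₑ ^ 2)) := by
  simp only [enorm_eq_nnnorm]
  norm_cast
  rw [← NNReal.coe_le_coe]
  push_cast
  have h (x y : Spinor) : ‖x‖ ≤ ‖y‖ + ‖x - y‖ := by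
    calc ‖x‖ = ‖y + (x - y)‖ := by congr 1; abel
      _ ≤ _ := norm_add_le _ _
  have hd : (0 : ℝ) < δ := by positivity
  have h2 (a b : ℝ) : 2 * a * b ≤ δ * a ^ 2 + (δ : ℝ)⁻¹ * b ^ 2 := by
    have h3 : (δ * a - b) ^ 2 * (δ : ℝ)⁻¹ = δ * a ^ 2 - 2 * a * b + (δ : ℝ)⁻¹ * b ^ 2 := by
      field_simp; ring
    have : 0 ≤ (δ * a - b) ^ 2 * (δ : ℝ)⁻¹ := by positivity
    linarith
  have h4 : ‖w‖ * ‖w'‖ ≤ (‖v‖ + ‖w - v‖) * (‖v'‖ + ‖w' - v'‖) := by gcongr <;> exact h _ _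
  have p1 : 0 ≤ δ * ‖v‖ ^ 2 := by positivity
  have p2 : 0 ≤ δ * ‖v'‖ ^ 2 := by positivity
  have p3 : 0 ≤ (δ : ℝ)⁻¹ * ‖w - v‖ ^ 2 := by positivity
  have p4 : 0 ≤ (δ : ℝ)⁻¹ * ‖w' - v'‖ ^ 2 := by positivity
  nlinarith [h2 ‖v‖ ‖w' - v'‖, h2 ‖v'‖ ‖w - v‖, sq_nonneg (‖w - v‖ - ‖w' - v'‖)]

theorem lintegral_gaussian_schwartz_le {t : ℝ} (ht : 0 < t) (f : 𝓢(R3, Spinor)) :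
    ∫⁻ x, ENNReal.ofReal (Real.exp (-(π * t) * ‖x‖ ^ 2)) * ‖f x‖ₑ ^ 2 ≤
      ∫⁻ p, ∫⁻ q, ENNReal.ofReal (heat t (p - q)) * ‖𝓕 (f : R3 → Spinor) p‖ₑ * ‖𝓕 (f : R3 → Spinor) q‖ₑ := by
  refine le_trans (le_of_eq ?_) (lintegral_gaussian_fourier_le ht (𝓕 f).integrable)
  rw [← lintegral_neg_eq_self (μ := volume)]
  refine lintegral_congr fun x => ?_
  have h : 𝓕 (𝓕 (f : R3 → Spinor)) x = f (-x) := by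
    rw [← congrFun (f.continuous.fourierInv_fourier_eq f.integrable (𝓕 f).integrable) (-x),
      Real.fourierInv_eq_fourier_neg, neg_neg]
  rw [norm_neg, ← h]

/-- In Fourier space multiplication by a Gaussian is convolution with a heat kernel; here only the
resulting upper bound of its quadratic form is stated. It passes from Schwartz functions to `L²` by
density, as both forms are continuous. -/
theorem lintegral_gaussian_le {t : ℝ} (ht : 0 < t) (f : Hrel) :
    ∫⁻ x, ENNReal.ofReal (Real.exp (-(π * t) * ‖x‖ ^ 2)) * ‖f x‖ₑ ^ 2 ≤
      ∫⁻ p, ∫⁻ q, ENNReal.ofReal (heat t (p - q)) * (‖fourierL2 f p‖ₑ * ‖fourierL2 f q‖ₑ) := by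
  set Q := ∫⁻ p, ∫⁻ q, ENNReal.ofReal (heat t (p - q)) * (‖fourierL2 f p‖ₑ * ‖fourierL2 f q‖ₑ)
    with hQ
  set N := ‖f‖ₑ ^ 2 with hN
  have hNtop : N ≠ ⊤ := by simp [N]
  have hGle : ∀ x : R3, ENNReal.ofReal (Real.exp (-(π * t) * ‖x‖ ^ 2)) ≤ 1 := fun x => by
    rw [← ENNReal.ofReal_one]
    refine ENNReal.ofReal_le_ofReal (Real.exp_le_one_iff.mpr ?_)
    have : 0 ≤ π * t * ‖x‖ ^ 2 := by positivity
    linarith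
  have main : ∀ δ : NNReal, δ ≠ 0 → δ ≤ 1 →
      ∫⁻ x, ENNReal.ofReal (Real.exp (-(π * t) * ‖x‖ ^ 2)) * ‖f x‖ₑ ^ 2 ≤
        Q + δ * (Q + 4 * (N + 2) + 2) := by
    intro δ hδ hδ1
    obtain ⟨g, hg⟩ := (SchwartzMap.denseRange_toLpCLM (E := R3) (F := Spinor) (p := 2)
      (μ := volume) ENNReal.ofNat_ne_top).exists_dist_lt f (ε := δ) (by positivity)
    set φ : Hrel := g.toLp 2 with hφ
    have hdist : ‖f - φ‖ₑ ≤ δ := by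
      rw [← ofReal_norm, ← dist_eq_norm]
      exact ENNReal.ofReal_le_of_le_toReal (by simpa using hg.le)
    have hd2 : ‖f - φ‖ₑ ^ 2 ≤ (δ : ℝ≥0∞) ^ 2 := by gcongr
    have hφg : φ =ᵐ[volume] g := g.coeFn_toLp 2 volume
    have hφF : fourierL2 φ =ᵐ[volume] (𝓕 g : 𝓢(R3, Spinor)) := by
      have h : fourierL2 φ = (𝓕 g).toLp 2 := SchwartzMap.toLp_fourier_eq g
      rw [h]
      exact (𝓕 g).coeFn_toLp 2 volume
    -- the Gaussian form of `φ`
    have h1 : ∫⁻ x, ENNReal.ofReal (Real.exp (-(π * t) * ‖x‖ ^ 2)) * ‖φ x‖ₑ ^ 2 ≤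
        ∫⁻ p, ∫⁻ q, ENNReal.ofReal (heat t (p - q)) * (‖fourierL2 φ p‖ₑ * ‖fourierL2 φ q‖ₑ) := by
      calc _ = ∫⁻ x, ENNReal.ofReal (Real.exp (-(π * t) * ‖x‖ ^ 2)) * ‖g x‖ₑ ^ 2 := by
            refine lintegral_congr_ae ?_
            filter_upwards [hφg] with x hx
            rw [hx]
        _ ≤ _ := lintegral_gaussian_schwartz_le ht g
        _ = _ := by
            refine lintegral_congr_ae ?_
            filter_upwards [hφF] with p hp
            refine lintegral_congr_ae ?_
            filter_upwards [hφF] with q hq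
            rw [hp, hq, mul_assoc]
            rfl
    let E : R3 → ℝ≥0∞ := fun p => δ * ‖fourierL2 f p‖ₑ ^ 2 +
      (1 + (δ⁻¹ : NNReal)) * ‖fourierL2 (φ - f) p‖ₑ ^ 2
    have hEm : Measurable E := by
      have := measurable_enorm_Lp (fourierL2 f)
      have := measurable_enorm_Lp (fourierL2 (φ - f))
      fun_prop
    have hE : ∫⁻ p, E p ≤ δ * (N + 2) := by
      have := measurable_enorm_Lp (fourierL2 f)
      have := measurable_enorm_Lp (fourierL2 (φ - f))
      simp only [E]
      rw [lintegral_add_left (by fun_prop), lintegral_const_mul _ (by fun_prop),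
        lintegral_const_mul _ (by fun_prop), lintegral_enorm_sq, lintegral_enorm_sq,
        LinearIsometryEquiv.enorm_map, LinearIsometryEquiv.enorm_map, ← enorm_neg (φ - f), neg_sub]
      calc _ ≤ δ * N + (1 + (δ⁻¹ : NNReal)) * (δ : ℝ≥0∞) ^ 2 := by gcongr
        _ = δ * (N + (1 + δ : NNReal)) := by
            have : (1 + ((δ⁻¹ : NNReal) : ℝ≥0∞)) * (δ : ℝ≥0∞) ^ 2 = δ * ((1 + δ : NNReal) : ℝ≥0∞) := by
              norm_cast
              rw [add_mul, sq, inv_mul_cancel_left₀ hδ]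
              ring
            rw [this, mul_add]
        _ ≤ _ := by
            gcongr
            norm_cast
            calc 1 + δ ≤ 1 + 1 := by gcongr
              _ = 2 := by norm_num
    have h2 : ∫⁻ p, ∫⁻ q, ENNReal.ofReal (heat t (p - q)) *
        (‖fourierL2 φ p‖ₑ * ‖fourierL2 φ q‖ₑ) ≤ Q + 2 * (δ * (N + 2)) := by
      have m1 := measurable_enorm_Lp (fourierL2 f)
      have mh := measurable_heat_sub t
      have hsub : ∀ᵐ p, fourierL2 (φ - f) p = fourierL2 φ p - fourierL2 f p := by
        rw [map_sub]
        exact Lp.coeFn_sub _ _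
      calc _ ≤ ∫⁻ p, ∫⁻ q, (ENNReal.ofReal (heat t (p - q)) *
              (‖fourierL2 f p‖ₑ * ‖fourierL2 f q‖ₑ) + (ENNReal.ofReal (heat t (p - q)) * E p +
              ENNReal.ofReal (heat t (p - q)) * E q)) := by
            refine lintegral_mono_ae ?_
            filter_upwards [hsub] with p hp
            refine lintegral_mono_ae ?_
            filter_upwards [hsub] with q hq
            rw [← mul_add, ← mul_add]
            gcongr
            simp only [E]
            rw [hp, hq]
            exact enorm_mul_enorm_le _ _ _ _ hδ
        _ = Q + ((∫⁻ p, E p) + (∫⁻ p, E p)) := by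
            have hk : Measurable (Function.uncurry fun _ q : R3 => E q) := hEm.comp measurable_snd
            have hswap := lintegral_lintegral_heat_swap t hk
            rw [lintegral_lintegral_heat_mul_left ht E] at hswap
            nth_rewrite 2 [← hswap]
            rw [← lintegral_lintegral_heat_mul_left ht E, hQ]
            have k1 : Measurable (Function.uncurry fun p q : R3 =>
                ENNReal.ofReal (heat t (p - q)) * (‖fourierL2 f p‖ₑ * ‖fourierL2 f q‖ₑ)) :=
              mh.mul ((m1.comp measurable_fst).mul (m1.comp measurable_snd))
            have k2 : Measurable (Function.uncurry fun p q : R3 =>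
                ENNReal.ofReal (heat t (p - q)) * E p) := mh.mul (hEm.comp measurable_fst)
            have k1' : Measurable fun p : R3 => ∫⁻ q, ENNReal.ofReal (heat t (p - q)) *
                (‖fourierL2 f p‖ₑ * ‖fourierL2 f q‖ₑ) := k1.lintegral_prod_right'
            have k2' : Measurable fun p : R3 => ∫⁻ q, ENNReal.ofReal (heat t (p - q)) * E p :=
              k2.lintegral_prod_right'
            rw [← lintegral_add_left k2', ← lintegral_add_left k1']
            refine lintegral_congr fun p => ?_
            exact (lintegral_add_left (k1.comp measurable_prodMk_left) _).trans
              (congrArg _ (lintegral_add_left (k2.comp measurable_prodMk_left) _))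
        _ ≤ Q + 2 * (δ * (N + 2)) := by
            rw [two_mul]
            gcongr
    have hδ1' : (δ : ℝ≥0∞) ≤ 1 := by exact_mod_cast hδ1
    have mG : Measurable fun x : R3 => ENNReal.ofReal (Real.exp (-(π * t) * ‖x‖ ^ 2)) := by fun_prop
    have mφ := measurable_enorm_Lp φ
    have md := measurable_enorm_Lp (f - φ)
    calc _ ≤ ∫⁻ x, ((1 + δ) * (ENNReal.ofReal (Real.exp (-(π * t) * ‖x‖ ^ 2)) * ‖φ x‖ₑ ^ 2) +
            (1 + (δ⁻¹ : NNReal)) * ‖(f - φ) x‖ₑ ^ 2) := by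
          refine lintegral_mono_ae ?_
          filter_upwards [Lp.coeFn_sub f φ] with x hx
          rw [hx, Pi.sub_apply]
          calc _ ≤ ENNReal.ofReal (Real.exp (-(π * t) * ‖x‖ ^ 2)) * ((1 + δ) * ‖φ x‖ₑ ^ 2 +
                (1 + (δ⁻¹ : NNReal)) * ‖f x - φ x‖ₑ ^ 2) := by
                gcongr
                exact enorm_sq_le _ _ hδ
            _ = (1 + δ) * (ENNReal.ofReal (Real.exp (-(π * t) * ‖x‖ ^ 2)) * ‖φ x‖ₑ ^ 2) +
                ENNReal.ofReal (Real.exp (-(π * t) * ‖x‖ ^ 2)) *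
                ((1 + (δ⁻¹ : NNReal)) * ‖f x - φ x‖ₑ ^ 2) := by ring
            _ ≤ _ := by
                exact add_le_add le_rfl (mul_le_of_le_one_left zero_le (hGle x))
      _ = (1 + δ) * (∫⁻ x, ENNReal.ofReal (Real.exp (-(π * t) * ‖x‖ ^ 2)) * ‖φ x‖ₑ ^ 2) +
            (1 + (δ⁻¹ : NNReal)) * ‖f - φ‖ₑ ^ 2 := by
          rw [lintegral_add_left (by fun_prop), lintegral_const_mul _ (by fun_prop),
            lintegral_const_mul _ (by fun_prop), lintegral_enorm_sq]
      _ ≤ (1 + δ) * (Q + 2 * (δ * (N + 2))) + (1 + (δ⁻¹ : NNReal)) * (δ : ℝ≥0∞) ^ 2 := by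
          gcongr
          exact h1.trans h2
      _ = Q + δ * (Q + 2 * ((1 + δ) * (N + 2)) + (1 + δ)) := by
          have : (1 + ((δ⁻¹ : NNReal) : ℝ≥0∞)) * (δ : ℝ≥0∞) ^ 2 = δ * (1 + δ : ℝ≥0∞) := by
            norm_cast
            rw [add_mul, sq, inv_mul_cancel_left₀ hδ]
            ring
          rw [this]
          ring
      _ ≤ Q + δ * (Q + 2 * ((1 + 1) * (N + 2)) + (1 + 1)) := by gcongr
      _ = _ := by ring
  refine ENNReal.le_of_forall_pos_le_add fun ε hε hQt => ?_
  set C : ℝ≥0∞ := Q + 4 * (N + 2) + 2 with hC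
  have hCt : C ≠ ⊤ := by finiteness
  have hC1 : 1 ≤ C := le_add_left (by norm_num)
  lift C to NNReal using hCt with c hc
  have hc1 : 1 ≤ c := by exact_mod_cast hC1
  have hc0 : 0 < c := lt_of_lt_of_le one_pos hc1
  refine (main (min 1 (ε / c)) (by positivity) (min_le_left _ _)).trans ?_
  rw [← ENNReal.coe_mul]
  gcongr
  calc min 1 (ε / c) * c ≤ ε / c * c := by gcongr; exact min_le_right _ _
    _ = ε := div_mul_cancel₀ _ hc0.ne'

/-! ### Herbst's inequality -/

/-- The Mellin transform `∫ v^(b-1) heat v q dv`, a multiple of `|q|^(2b-3)`. -/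
def rieszWeight (b : ℝ) (q : R3) : ℝ :=
  (1 / (π * ‖q‖ ^ 2)) ^ (3 / 2 - b) * Real.Gamma (3 / 2 - b)

theorem rieszWeight_pos {b : ℝ} (hb : b < 3 / 2) {q : R3} (hq : q ≠ 0) : 0 < rieszWeight b q := by
  have hq' : 0 < ‖q‖ := norm_pos_iff.mpr hq
  have : 0 < Real.Gamma (3 / 2 - b) := Real.Gamma_pos_of_pos (by linarith)
  unfold rieszWeight
  positivity

theorem measurable_rieszWeight (b : ℝ) : Measurable (rieszWeight b) := by
  unfold rieszWeight
  fun_prop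

theorem ae_ne_zero : ∀ᵐ p : R3, p ≠ 0 := by
  simp [ae_iff]

/-- The semigroup property: a heat kernel acts on a Riesz weight by shifting the time in the Mellin
integral that defines it. -/
theorem lintegral_heat_mul_rieszWeight {t b : ℝ} (ht : 0 < t) (hb : b < 3 / 2) (p : R3) :
    ∫⁻ q, ENNReal.ofReal (heat t (p - q)) * ENNReal.ofReal (rieszWeight b q) =
      ∫⁻ v in Ioi (0 : ℝ), ENNReal.ofReal (v ^ (b - 1)) * ENNReal.ofReal (heat (t + v) p) := by
  have m : Measurable fun x : R3 × ℝ => ENNReal.ofReal (heat t (p - x.1)) *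
      (ENNReal.ofReal (x.2 ^ (b - 1)) * ENNReal.ofReal (heat x.2 x.1)) := by
    unfold heat
    fun_prop
  calc _ = ∫⁻ q, ∫⁻ v in Ioi (0 : ℝ), ENNReal.ofReal (heat t (p - q)) *
        (ENNReal.ofReal (v ^ (b - 1)) * ENNReal.ofReal (heat v q)) := by
        refine lintegral_congr_ae ?_
        filter_upwards [ae_ne_zero] with q hq
        rw [lintegral_const_mul' _ _ ENNReal.ofReal_ne_top, lintegral_rpow_mul_heat hb hq]
        rfl
    _ = ∫⁻ v in Ioi (0 : ℝ), ∫⁻ q, ENNReal.ofReal (heat t (p - q)) *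
        (ENNReal.ofReal (v ^ (b - 1)) * ENNReal.ofReal (heat v q)) :=
        lintegral_lintegral_swap m.aemeasurable
    _ = _ := by
        refine setLIntegral_congr_fun measurableSet_Ioi fun v hv => ?_
        rw [← lintegral_heat_mul_heat ht hv, ← lintegral_const_mul' _ _ ENNReal.ofReal_ne_top]
        refine lintegral_congr fun q => ?_
        ring

/-- Averaging over the time with weight `t^(a-1)` maps the Riesz weight of order `b` to a multiple of
the one of order `a + b`. -/
theorem lintegral_rpow_mul_heat_mul_rieszWeight {a b : ℝ} (ha : 0 < a) (hb : 0 < b)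
    (hab : a + b < 3 / 2) {p : R3} (hp : p ≠ 0) :
    ∫⁻ t in Ioi (0 : ℝ), ENNReal.ofReal (t ^ (a - 1)) *
        ∫⁻ q, ENNReal.ofReal (heat t (p - q)) * ENNReal.ofReal (rieszWeight b q) =
      ENNReal.ofReal (ProbabilityTheory.beta a b) * ENNReal.ofReal (rieszWeight (a + b) p) := by
  have hm : Measurable fun T : ℝ => ENNReal.ofReal (heat T p) := by
    unfold heat
    fun_prop
  unfold rieszWeight
  rw [← lintegral_rpow_mul_heat hab hp, ← lintegral_rpow_conv ha hb hm]
  refine setLIntegral_congr_fun measurableSet_Ioi fun t ht => ?_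
  have := lintegral_heat_mul_rieszWeight ht (show b < 3 / 2 by linarith) p
  unfold rieszWeight at this
  rw [this, ← lintegral_const_mul' _ _ ENNReal.ofReal_ne_top]
  refine lintegral_congr fun v => ?_
  ring

/-- The Schur test for the heat kernel with a positive weight `w`. -/
theorem lintegral_heat_schur (t : ℝ) {w : R3 → ℝ} (hw : Measurable w)
    (hpos : ∀ᵐ p, 0 < w p) (k : Hrel) :
    ∫⁻ p, ∫⁻ q, ENNReal.ofReal (heat t (p - q)) * (‖k p‖ₑ * ‖k q‖ₑ) ≤
      2 * ∫⁻ p, ENNReal.ofReal (‖k p‖ ^ 2 / (2 * w p)) *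
        ∫⁻ q, ENNReal.ofReal (heat t (p - q)) * ENNReal.ofReal (w q) := by
  have mk : Measurable k := (Lp.stronglyMeasurable k).measurable
  let D : R3 → ℝ≥0∞ := fun p => ENNReal.ofReal (‖k p‖ ^ 2 / (2 * w p))
  have mD : Measurable D := by fun_prop
  let K : R3 → R3 → ℝ≥0∞ := fun p q => D p * ENNReal.ofReal (w q)
  have mK : Measurable (Function.uncurry K) :=
    (mD.comp measurable_fst).mul (hw.comp measurable_snd).ennreal_ofReal
  have mh := measurable_heat_sub t
  have m1 : Measurable (Function.uncurry fun p q => ENNReal.ofReal (heat t (p - q)) * K p q) :=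
    mh.mul mK
  have m1' : Measurable fun p => ∫⁻ q, ENNReal.ofReal (heat t (p - q)) * K p q :=
    m1.lintegral_prod_right'
  calc _ ≤ ∫⁻ p, ∫⁻ q, (ENNReal.ofReal (heat t (p - q)) * K p q +
          ENNReal.ofReal (heat t (p - q)) * K q p) := by
        refine lintegral_mono_ae ?_
        filter_upwards [hpos] with p hp
        refine lintegral_mono_ae ?_
        filter_upwards [hpos] with q hq
        rw [← mul_add]
        gcongr
        simp only [K, D, ← ofReal_norm]
        rw [← ENNReal.ofReal_mul (by positivity), ← ENNReal.ofReal_mul (by positivity),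
          ← ENNReal.ofReal_mul (by positivity), ← ENNReal.ofReal_add (by positivity) (by positivity)]
        refine ENNReal.ofReal_le_ofReal ?_
        have : ‖k p‖ ^ 2 / (2 * w p) * w q + ‖k q‖ ^ 2 / (2 * w q) * w p - ‖k p‖ * ‖k q‖ =
            (‖k p‖ * w q - ‖k q‖ * w p) ^ 2 / (2 * w p * w q) := by
          field_simp
          ring
        have h2 : 0 ≤ (‖k p‖ * w q - ‖k q‖ * w p) ^ 2 / (2 * w p * w q) := by positivity
        linarith
    _ = 2 * ∫⁻ p, ∫⁻ q, ENNReal.ofReal (heat t (p - q)) * K p q := by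
        rw [two_mul]
        nth_rewrite 2 [lintegral_lintegral_heat_swap t mK]
        rw [← lintegral_add_left m1']
        refine lintegral_congr fun p => ?_
        exact lintegral_add_left (m1.comp measurable_prodMk_left) _
    _ = _ := by
        congr 1
        refine lintegral_congr fun p => ?_
        rw [← lintegral_const_mul' _ _ ENNReal.ofReal_ne_top]
        refine lintegral_congr fun q => ?_
        simp only [K, D]
        ring

/-- **Herbst's inequality** `‖|x|^(-a) f‖ ≤ M_a ‖|p|^a f‖` with `p = 2πξ`. -/
theorem lintegral_norm_rpow_le {a : ℝ} (ha : 0 < a) (ha' : a < 3 / 2) (f : Hrel) :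
    ∫⁻ x, ENNReal.ofReal (‖x‖ ^ (-(2 * a))) * ‖f x‖ₑ ^ 2 ≤ ENNReal.ofReal (Mconst a ^ 2) *
      ∫⁻ ξ, ENNReal.ofReal ((2 * π * ‖ξ‖) ^ (2 * a)) * ‖fourierL2 f ξ‖ₑ ^ 2 := by
  set b : ℝ := 3 / 4 - a / 2 with hb
  have hb0 : 0 < b := by rw [hb]; linarith
  have hab : a + b < 3 / 2 := by rw [hb]; linarith
  have hΓa : 0 < Real.Gamma a := Real.Gamma_pos_of_pos ha
  have hΓb : 0 < Real.Gamma b := Real.Gamma_pos_of_pos hb0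
  have hΓab : 0 < Real.Gamma (a + b) := Real.Gamma_pos_of_pos (by linarith)
  set c : ℝ := Real.Gamma a * (1 / π) ^ a with hc
  have hc0 : 0 < c := by positivity
  have mf : Measurable f := (Lp.stronglyMeasurable f).measurable
  set k := fourierL2 f with hk
  have mk : Measurable k := (Lp.stronglyMeasurable k).measurable
  have mw := measurable_rieszWeight b
  have hpos : ∀ᵐ p, 0 < rieszWeight b p := by
    filter_upwards [ae_ne_zero] with p hp
    exact rieszWeight_pos (by linarith) hp
  refine (ENNReal.mul_le_mul_iff_right (a := ENNReal.ofReal c) (by simpa using hc0)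
    ENNReal.ofReal_ne_top).mp ?_
  have mh : Measurable fun x : (R3 × ℝ) × R3 => ENNReal.ofReal (heat x.1.2 (x.1.1 - x.2)) *
      ENNReal.ofReal (rieszWeight b x.2) := by
    unfold heat
    fun_prop
  have mh' : Measurable fun x : R3 × ℝ => ∫⁻ q, ENNReal.ofReal (heat x.2 (x.1 - q)) *
      ENNReal.ofReal (rieszWeight b q) := mh.lintegral_prod_right'
  calc _ = ∫⁻ x, ∫⁻ t in Ioi (0 : ℝ), ENNReal.ofReal (t ^ (a - 1)) *
          (ENNReal.ofReal (Real.exp (-(π * t) * ‖x‖ ^ 2)) * ‖f x‖ₑ ^ 2) := by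
        rw [← lintegral_const_mul' _ _ ENNReal.ofReal_ne_top]
        refine lintegral_congr_ae ?_
        filter_upwards [ae_ne_zero] with x hx
        have hx' : 0 < ‖x‖ := norm_pos_iff.mpr hx
        have h := lintegral_rpow_mul_exp_neg_mul (r := π * ‖x‖ ^ 2) ha (by positivity)
        have e : (1 / (π * ‖x‖ ^ 2)) ^ a * Real.Gamma a = c * ‖x‖ ^ (-(2 * a)) := by
          rw [hc, one_div, mul_inv, Real.mul_rpow (by positivity) (by positivity),
            Real.rpow_neg hx'.le, Real.rpow_mul hx'.le, Real.rpow_two,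
            Real.inv_rpow (x := ‖x‖ ^ 2) (by positivity), one_div]
          ring
        rw [← mul_assoc, ← ENNReal.ofReal_mul hc0.le, ← e, ← h,
          ← lintegral_mul_const' _ _ (by finiteness)]
        refine setLIntegral_congr_fun measurableSet_Ioi fun t ht => ?_
        rw [ENNReal.ofReal_mul (Real.rpow_nonneg (le_of_lt ht) _), ← mul_assoc]
        congr 4
        ring
    _ = ∫⁻ t in Ioi (0 : ℝ), ENNReal.ofReal (t ^ (a - 1)) *
          ∫⁻ x, ENNReal.ofReal (Real.exp (-(π * t) * ‖x‖ ^ 2)) * ‖f x‖ₑ ^ 2 := by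
        rw [lintegral_lintegral_swap]
        · refine lintegral_congr fun t => ?_
          rw [lintegral_const_mul' _ _ ENNReal.ofReal_ne_top]
        · refine Measurable.aemeasurable ?_
          fun_prop
    _ ≤ ∫⁻ t in Ioi (0 : ℝ), ENNReal.ofReal (t ^ (a - 1)) *
          (2 * ∫⁻ p, ENNReal.ofReal (‖k p‖ ^ 2 / (2 * rieszWeight b p)) *
          ∫⁻ q, ENNReal.ofReal (heat t (p - q)) * ENNReal.ofReal (rieszWeight b q)) := by
        refine setLIntegral_mono' measurableSet_Ioi fun t ht => ?_
        gcongr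
        exact (lintegral_gaussian_le ht f).trans (lintegral_heat_schur t mw hpos k)
    _ = ∫⁻ p, ∫⁻ t in Ioi (0 : ℝ), 2 * ENNReal.ofReal (‖k p‖ ^ 2 / (2 * rieszWeight b p)) *
          (ENNReal.ofReal (t ^ (a - 1)) *
          ∫⁻ q, ENNReal.ofReal (heat t (p - q)) * ENNReal.ofReal (rieszWeight b q)) := by
        rw [lintegral_lintegral_swap]
        · refine lintegral_congr fun t => ?_
          rw [← lintegral_const_mul' _ _ (by norm_num),
            ← lintegral_const_mul' _ _ ENNReal.ofReal_ne_top]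
          refine lintegral_congr fun p => ?_
          ring
        · refine Measurable.aemeasurable ?_
          have : Measurable fun p => 2 * ENNReal.ofReal (‖k p‖ ^ 2 / (2 * rieszWeight b p)) := by
            fun_prop
          have h3 : Measurable fun t : ℝ => ENNReal.ofReal (t ^ (a - 1)) := by fun_prop
          exact (this.comp measurable_fst).mul ((h3.comp measurable_snd).mul mh')
    _ = ∫⁻ p, ENNReal.ofReal c * (ENNReal.ofReal (Mconst a ^ 2) *
          (ENNReal.ofReal ((2 * π * ‖p‖) ^ (2 * a)) * ‖k p‖ₑ ^ 2)) := by
        refine lintegral_congr_ae ?_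
        filter_upwards [ae_ne_zero, hpos] with p hp hwp
        have hp' : 0 < ‖p‖ := norm_pos_iff.mpr hp
        rw [lintegral_const_mul' _ _ (by finiteness),
          lintegral_rpow_mul_heat_mul_rieszWeight ha hb0 hab hp, ← ofReal_norm,
          ← ENNReal.ofReal_pow (norm_nonneg _)]
        have hB := ProbabilityTheory.beta_pos ha hb0
        have hW := rieszWeight_pos hab hp
        have h22 (r : ℝ) : 2 * ENNReal.ofReal r = ENNReal.ofReal (2 * r) := by
          rw [ENNReal.ofReal_mul (by norm_num), ENNReal.ofReal_ofNat]
        rw [← ENNReal.ofReal_mul (by positivity), ← ENNReal.ofReal_mul (by positivity),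
          ← ENNReal.ofReal_mul (by positivity), ← ENNReal.ofReal_mul (by positivity),
          h22, ← ENNReal.ofReal_mul (by positivity)]
        congr 1
        -- the exponents `3/2 - (a+b) = b` and `3/2 - b = a+b` swap the two Gamma factors
        have e1 : 3 / 2 - (a + b) = b := by rw [hb]; ring
        have e2 : 3 / 2 - b = a + b := by rw [hb]; ring
        have e3 : 3 / 4 + a / 2 = a + b := by rw [hb]; ring
        have r1 : (1 / (π * ‖p‖ ^ 2)) ^ (a + b) = (1 / π) ^ a * (1 / ‖p‖ ^ 2) ^ a *
            (1 / (π * ‖p‖ ^ 2)) ^ b := by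
          rw [Real.rpow_add (by positivity), ← Real.mul_rpow (by positivity) (by positivity)]
          congr 2
          field_simp
        have r2 : (2 * π * ‖p‖) ^ (2 * a) = (2 ^ a * 2 ^ a) * ((1 / π) ^ a * (1 / π) ^ a)⁻¹ *
            ((1 / ‖p‖ ^ 2) ^ a)⁻¹ := by
          rw [Real.rpow_mul (by positivity), Real.rpow_two,
            ← Real.mul_rpow (x := (2 : ℝ)) (by positivity) (by positivity),
            ← Real.mul_rpow (x := 1 / π) (by positivity) (by positivity),
            ← Real.inv_rpow (by positivity), ← Real.inv_rpow (by positivity),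
            ← Real.mul_rpow (by positivity) (by positivity),
            ← Real.mul_rpow (by positivity) (by positivity)]
          congr 1
          field_simp
        have r3 : (2 : ℝ) ^ (-a) = (2 ^ a)⁻¹ := Real.rpow_neg (by norm_num) _
        simp only [rieszWeight, Mconst, ProbabilityTheory.beta, e1, e2, ← hb, e3, hc, r1, r2, r3]
        have n1 : 0 < (1 / (π * ‖p‖ ^ 2)) ^ b := by positivity
        have n2 : 0 < (1 / ‖p‖ ^ 2) ^ a := by positivity
        have n3 : 0 < (1 / π) ^ a := by positivity
        have n4 : (0 : ℝ) < 2 ^ a := by positivity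
        generalize (1 / (π * ‖p‖ ^ 2)) ^ b = A at *
        generalize (1 / ‖p‖ ^ 2) ^ a = B at *
        generalize (1 / π) ^ a = C at *
        generalize (2 : ℝ) ^ a = D at *
        field_simp
    _ = _ := by
        rw [lintegral_const_mul' _ _ ENNReal.ofReal_ne_top,
          lintegral_const_mul' _ _ ENNReal.ofReal_ne_top]

/-! ### Algebra of the symbols -/

theorem MminusDot_eq (p : R3) : MminusDot p = alphaDot p ⊗ₖ 1 - 1 ⊗ₖ alphaDot p := by
  simp only [MminusDot, Mminus, alphaDot, Fin.sum_univ_three, Matrix.add_kronecker,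
    Matrix.kronecker_add, Matrix.smul_kronecker, Matrix.kronecker_smul, smul_sub]
  abel

theorem beta_mul_self : beta * beta = 1 := by
  simp [beta, Matrix.fromBlocks_multiply]

theorem beta_mul_alphaDot (p : R3) : beta * alphaDot p = -(alphaDot p * beta) := by
  rw [alphaDot_eq, beta, Matrix.fromBlocks_multiply, Matrix.fromBlocks_multiply,
    Matrix.fromBlocks_neg]
  simp

theorem beta_conjTranspose : beta.conjTranspose = beta := by
  simp [beta, Matrix.fromBlocks_conjTranspose]

/-- The symbol `P₊(p) = (1 + τ(p)) / 2`. -/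
def projSymbol (p : R3) : Matrix Idx16 Idx16 ℂ := (2⁻¹ : ℂ) • (1 + tauMatrix p)

/-- The symbol `M⁻·p + B`, the free operator without the projection. -/
def diracSymbol (p : R3) : Matrix Idx16 Idx16 ℂ := MminusDot p + Bmatrix

theorem sq_smul_tauMatrix (p : R3) :
    ((‖p‖ ^ 2 : ℝ) : ℂ) • tauMatrix p = -(alphaDot p ⊗ₖ alphaDot p) := by
  rcases eq_or_ne p 0 with rfl | hp
  · simp [alphaDot]
  · have h : ((‖p‖ ^ 2 : ℝ) : ℂ) ≠ 0 := by exact_mod_cast pow_ne_zero 2 (norm_ne_zero_iff.mpr hp)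
    rw [tauMatrix, smul_neg, smul_smul, Complex.ofReal_inv, mul_inv_cancel₀ h, one_smul]

theorem MminusDot_mul_self (p : R3) :
    MminusDot p * MminusDot p = ((4 * ‖p‖ ^ 2 : ℝ) : ℂ) • projSymbol p := by
  have h : ((4 * ‖p‖ ^ 2 : ℝ) : ℂ) • projSymbol p =
      (2 : ℂ) • (((‖p‖ ^ 2 : ℝ) : ℂ) • (1 : Matrix Idx16 Idx16 ℂ) +
        ((‖p‖ ^ 2 : ℝ) : ℂ) • tauMatrix p) := by
    rw [projSymbol, ← smul_add, smul_smul, smul_smul]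
    congr 1
    push_cast
    ring
  rw [h, sq_smul_tauMatrix, MminusDot_eq, sub_mul, mul_sub, mul_sub]
  simp only [← Matrix.mul_kronecker_mul, one_mul, mul_one, alphaDot_sq, Matrix.smul_kronecker,
    Matrix.kronecker_smul, Matrix.one_kronecker_one]
  module

theorem MminusDot_mul_tauMatrix {p : R3} (hp : p ≠ 0) :
    MminusDot p * tauMatrix p = MminusDot p := by
  have h : ((‖p‖ ^ 2 : ℝ) : ℂ) ≠ 0 := by exact_mod_cast pow_ne_zero 2 (norm_ne_zero_iff.mpr hp)
  refine smul_right_injective _ h ?_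
  simp only
  rw [← Matrix.mul_smul, sq_smul_tauMatrix, MminusDot_eq, mul_neg, sub_mul]
  simp only [← Matrix.mul_kronecker_mul, one_mul, alphaDot_sq, Matrix.smul_kronecker,
    Matrix.kronecker_smul]
  module

theorem tauMatrix_mul_MminusDot {p : R3} (hp : p ≠ 0) :
    tauMatrix p * MminusDot p = MminusDot p := by
  have h : ((‖p‖ ^ 2 : ℝ) : ℂ) ≠ 0 := by exact_mod_cast pow_ne_zero 2 (norm_ne_zero_iff.mpr hp)
  refine smul_right_injective _ h ?_
  simp only
  rw [← Matrix.smul_mul, sq_smul_tauMatrix, MminusDot_eq, neg_mul, mul_sub]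
  simp only [← Matrix.mul_kronecker_mul, mul_one, alphaDot_sq, Matrix.smul_kronecker,
    Matrix.kronecker_smul]
  module

theorem Bmatrix_mul_self : Bmatrix * Bmatrix = (4 : ℂ) • 1 := by
  rw [Bmatrix, smul_mul_smul_comm, ← Matrix.mul_kronecker_mul, beta_mul_self,
    Matrix.one_kronecker_one]
  norm_num

theorem Bmatrix_mul_MminusDot (p : R3) : Bmatrix * MminusDot p = -(MminusDot p * Bmatrix) := by
  rw [Bmatrix, MminusDot_eq, Matrix.smul_mul, Matrix.mul_smul, mul_sub, sub_mul]
  simp only [← Matrix.mul_kronecker_mul, mul_one, one_mul, beta_mul_alphaDot]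
  rw [← neg_one_smul ℂ (alphaDot p * beta), Matrix.smul_kronecker, Matrix.kronecker_smul]
  module

theorem Bmatrix_mul_tauMatrix (p : R3) : Bmatrix * tauMatrix p = tauMatrix p * Bmatrix := by
  rw [Bmatrix, tauMatrix, Matrix.smul_mul, Matrix.mul_smul, mul_neg, neg_mul, Matrix.smul_mul,
    Matrix.mul_smul]
  simp only [← Matrix.mul_kronecker_mul, beta_mul_alphaDot]
  rw [← neg_one_smul ℂ (alphaDot p * beta), Matrix.smul_kronecker, Matrix.kronecker_smul]
  module

theorem diracSymbol_mul_self (p : R3) : diracSymbol p * diracSymbol p =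
    ((4 * ‖p‖ ^ 2 : ℝ) : ℂ) • projSymbol p + (4 : ℂ) • 1 := by
  rw [diracSymbol, add_mul, mul_add, mul_add, MminusDot_mul_self, Bmatrix_mul_self,
    Bmatrix_mul_MminusDot]
  abel

theorem projSymbol_mul_self {p : R3} (hp : p ≠ 0) :
    projSymbol p * projSymbol p = projSymbol p := by
  rw [projSymbol, smul_mul_smul_comm, add_mul, mul_add, mul_add, tauMatrix_sq hp]
  simp only [one_mul, mul_one]
  module

theorem projSymbol_mul_diracSymbol {p : R3} (hp : p ≠ 0) :
    projSymbol p * diracSymbol p = diracSymbol p * projSymbol p := by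
  simp only [projSymbol, diracSymbol, Matrix.smul_mul, Matrix.mul_smul, add_mul, mul_add, one_mul,
    mul_one, MminusDot_mul_tauMatrix hp, tauMatrix_mul_MminusDot hp, Bmatrix_mul_tauMatrix]

theorem diracSymbol_conjTranspose (p : R3) : (diracSymbol p).conjTranspose = diracSymbol p := by
  rw [diracSymbol, MminusDot_eq, Bmatrix]
  simp [Matrix.conjTranspose_kronecker, alphaDot_conjTranspose, beta_conjTranspose]

theorem norm_projSymbol_le (p : R3) (v : Spinor) : ‖matMap (projSymbol p) v‖ ≤ ‖v‖ := by
  have h : matMap (projSymbol p) v = (2⁻¹ : ℂ) • (v + matMap (tauMatrix p) v) := by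
    simp [matMap, projSymbol, map_smul, map_add]
  rw [h, norm_smul]
  have := norm_tau_apply_le p v
  have h2 := norm_add_le v (matMap (tauMatrix p) v)
  norm_num
  linarith

/-- The relativistic energy `2 √(p² + 1)`, the absolute value of the free operator on `H₊`. -/
def energy (p : R3) : ℝ := 2 * √(‖p‖ ^ 2 + 1)

theorem energy_sq (p : R3) : energy p ^ 2 = 4 * (‖p‖ ^ 2 + 1) := by
  rw [energy, mul_pow, Real.sq_sqrt (by positivity)]
  norm_num

theorem two_le_energy (p : R3) : 2 ≤ energy p := by
  have h : 1 ≤ √(‖p‖ ^ 2 + 1) := Real.one_le_sqrt.mpr (by nlinarith [norm_nonneg p])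
  unfold energy
  linarith

theorem energy_pos (p : R3) : 0 < energy p := by linarith [two_le_energy p]

theorem norm_diracSymbol_le (p : R3) (v : Spinor) :
    ‖matMap (diracSymbol p) v‖ ≤ energy p * ‖v‖ := by
  have hs : star (matMap (diracSymbol p)) = matMap (diracSymbol p) := by
    rw [matMap, ← map_star, Matrix.star_eq_conjTranspose, diracSymbol_conjTranspose]
  have hm : matMap (diracSymbol p) (matMap (diracSymbol p) v) =
      ((4 * ‖p‖ ^ 2 : ℝ) : ℂ) • matMap (projSymbol p) v + (4 : ℂ) • v := by
    rw [← mul_apply_eq_comp, matMap, ← map_mul, diracSymbol_mul_self]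
    simp
  have h1 : ‖matMap (diracSymbol p) v‖ ^ 2 ≤ (energy p * ‖v‖) ^ 2 := by
    have e : ((‖matMap (diracSymbol p) v‖ ^ 2 : ℝ) : ℂ) =
        inner ℂ v (matMap (diracSymbol p) (matMap (diracSymbol p) v)) := by
      nth_rewrite 2 [← hs]
      rw [ContinuousLinearMap.star_eq_adjoint, ContinuousLinearMap.adjoint_inner_right,
        inner_self_eq_norm_sq_to_K]
      push_cast
      rfl
    have h2 : ‖matMap (diracSymbol p) v‖ ^ 2 ≤
        ‖v‖ * ‖matMap (diracSymbol p) (matMap (diracSymbol p) v)‖ := by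
      calc _ = ‖((‖matMap (diracSymbol p) v‖ ^ 2 : ℝ) : ℂ)‖ := by
            rw [Complex.norm_real, Real.norm_of_nonneg (by positivity)]
        _ ≤ _ := by
            rw [e]
            exact norm_inner_le_norm _ _
    have h3 : ‖matMap (diracSymbol p) (matMap (diracSymbol p) v)‖ ≤
        4 * ‖p‖ ^ 2 * ‖v‖ + 4 * ‖v‖ := by
      rw [hm]
      refine (norm_add_le _ _).trans ?_
      rw [norm_smul, norm_smul, Complex.norm_real, Real.norm_of_nonneg (by positivity)]
      gcongr
      · exact norm_projSymbol_le p v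
      · norm_num
    rw [mul_pow, energy_sq]
    nlinarith [norm_nonneg v]
  exact le_of_sq_le_sq h1 (mul_nonneg (energy_pos p).le (norm_nonneg _))

/-! ### Bounded Fourier multipliers -/

theorem aestronglyMeasurable_matMap {m : R3 → Matrix Idx16 Idx16 ℂ}
    (hm : ∀ i k, Measurable fun p => m p i k) {f : R3 → Spinor}
    (hf : AEStronglyMeasurable f volume) :
    AEStronglyMeasurable (fun p => matMap (m p) (f p)) volume := by
  have hf' : AEMeasurable f volume := hf.aemeasurable
  refine AEMeasurable.aestronglyMeasurable ?_
  have h : AEMeasurable (fun p : R3 => fun i => ∑ k, m p i k * f p k) volume := by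
    refine aemeasurable_pi_iff.mpr fun i => ?_
    refine Finset.aemeasurable_fun_sum _ fun k _ => (hm i k).aemeasurable.mul ?_
    fun_prop
  exact (PiLp.continuous_toLp 2 _).measurable.comp_aemeasurable h

theorem memLp_matMap {m : R3 → Matrix Idx16 Idx16 ℂ} (hm : ∀ i k, Measurable fun p => m p i k)
    {C : ℝ} (hC : ∀ p v, ‖matMap (m p) v‖ ≤ C * ‖v‖) (f : Hrel) :
    MemLp (fun p => matMap (m p) (f p)) 2 volume :=
  (Lp.memLp f).of_le_mul (aestronglyMeasurable_matMap hm (Lp.memLp f).1)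
    (Filter.Eventually.of_forall fun p => hC p _)

/-- The bounded Fourier multiplier with a measurable, bounded matrix-valued symbol. -/
def fourierMulCLM (m : R3 → Matrix Idx16 Idx16 ℂ) (hm : ∀ i k, Measurable fun p => m p i k)
    (C : ℝ) (hC : ∀ p v, ‖matMap (m p) v‖ ≤ C * ‖v‖) : Hrel →L[ℂ] Hrel :=
  LinearMap.mkContinuous
    { toFun := fun f => fourierMul (fun p => matMap (m p)) ⟨f, memLp_matMap hm hC (fourierL2 f)⟩
      map_add' := fun f g => (fourierMul fun p => matMap (m p)).map_add
        ⟨f, memLp_matMap hm hC (fourierL2 f)⟩ ⟨g, memLp_matMap hm hC (fourierL2 g)⟩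
      map_smul' := fun c f => (fourierMul fun p => matMap (m p)).map_smul c
        ⟨f, memLp_matMap hm hC (fourierL2 f)⟩ }
    C (by
      intro f
      change ‖fourierL2.symm (MemLp.toLp (fun p => matMap (m p) (fourierL2 f p))
        (memLp_matMap hm hC (fourierL2 f)))‖ ≤ _
      rw [LinearIsometryEquiv.norm_map, ← LinearIsometryEquiv.norm_map fourierL2 f]
      refine Lp.norm_le_mul_norm_of_ae_le_mul ?_
      filter_upwards [MemLp.coeFn_toLp (memLp_matMap hm hC (fourierL2 f))] with p hp
      rw [hp]
      exact hC p _)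

theorem fourierL2_fourierMul {m : R3 → Spinor →L[ℂ] Spinor} (f : (fourierMul m).domain) :
    fourierL2 (fourierMul m f) =ᵐ[volume] fun p => m p (fourierL2 f.1 p) := by
  change fourierL2 (fourierL2.symm (MemLp.toLp (fun p => m p (fourierL2 f.1 p))
    (mem_mulDomain.mp (Submodule.mem_comap.mp f.2)))) =ᵐ[volume] _
  rw [LinearIsometryEquiv.apply_symm_apply]
  exact MemLp.coeFn_toLp _

theorem fourierL2_fourierMulCLM {m : R3 → Matrix Idx16 Idx16 ℂ}
    {hm : ∀ i k, Measurable fun p => m p i k} {C : ℝ} {hC : ∀ p v, ‖matMap (m p) v‖ ≤ C * ‖v‖}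
    (f : Hrel) :
    fourierL2 (fourierMulCLM m hm C hC f) =ᵐ[volume] fun p => matMap (m p) (fourierL2 f p) :=
  fourierL2_fourierMul (m := fun p => matMap (m p)) ⟨f, memLp_matMap hm hC (fourierL2 f)⟩

theorem tauMatrix_smul {c : ℝ} (hc : c ≠ 0) (p : R3) : tauMatrix (c • p) = tauMatrix p := by
  have h : alphaDot (c • p) = (c : ℂ) • alphaDot p := by
    simp only [alphaDot, Finset.smul_sum, smul_smul, PiLp.smul_apply, smul_eq_mul,
      Complex.ofReal_mul]
  rw [tauMatrix, tauMatrix, h, Matrix.smul_kronecker, Matrix.kronecker_smul, smul_smul, smul_smul,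
    norm_smul]
  congr 2
  have hc' : (c : ℂ) ≠ 0 := by exact_mod_cast hc
  rw [mul_pow, Real.norm_eq_abs, sq_abs, mul_inv]
  push_cast
  field_simp

/-- The momentum `p = 2πξ` belonging to the frequency `ξ`. -/
def momentum (ξ : R3) : R3 := (2 * Real.pi) • ξ

theorem norm_momentum (ξ : R3) : ‖momentum ξ‖ = 2 * π * ‖ξ‖ := by
  rw [momentum, norm_smul, Real.norm_of_nonneg (by positivity)]

theorem momentum_ne_zero {ξ : R3} (h : ξ ≠ 0) : momentum ξ ≠ 0 :=
  smul_ne_zero (by positivity) h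

theorem projSymbol_momentum (ξ : R3) : projSymbol (momentum ξ) = projSymbol ξ := by
  rw [projSymbol, momentum, tauMatrix_smul (by positivity), projSymbol]

theorem fourierL2_Pplus (f : Hrel) : fourierL2 (Pplus f) =ᵐ[volume]
    fun ξ => matMap (projSymbol (momentum ξ)) (fourierL2 f ξ) := by
  have h : fourierL2 (tau f) =ᵐ[volume] fun p => matMap (tauMatrix p) (fourierL2 f p) :=
    fourierL2_fourierMul (m := fun p => matMap (tauMatrix p)) ⟨f, mem_domain_tau f⟩
  have e : fourierL2 (Pplus f) = (2⁻¹ : ℂ) • (fourierL2 f + fourierL2 (tau f)) := by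
    rw [← map_add, ← map_smul]
    rfl
  rw [e]
  filter_upwards [h, Lp.coeFn_smul (2⁻¹ : ℂ) (fourierL2 f + fourierL2 (tau f)),
    Lp.coeFn_add (fourierL2 f) (fourierL2 (tau f))] with ξ h1 h2 h3
  rw [h2, Pi.smul_apply, h3, Pi.add_apply, h1, projSymbol_momentum]
  simp [projSymbol]

theorem Bop_ae (f : Hrel) : Bop f =ᵐ[volume] fun x => matMap Bmatrix (f x) :=
  ContinuousLinearMap.coeFn_compLp _ f

/-- A constant matrix commutes with the Fourier transform. -/
theorem fourierL2_Bop (f : Hrel) : fourierL2 (Bop f) = Bop (fourierL2 f) := by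
  have hcl : Continuous fun f : Hrel => fourierL2 (Bop f) :=
    fourierL2.continuous.comp Bop.continuous
  have hcr : Continuous fun f : Hrel => Bop (fourierL2 f) :=
    Bop.continuous.comp fourierL2.continuous
  refine congrFun (DenseRange.equalizer (SchwartzMap.denseRange_toLpCLM (E := R3) (F := Spinor)
    (p := 2) (μ := volume) ENNReal.ofNat_ne_top) hcl hcr (funext fun g => ?_)) f
  have hB : ∀ g : 𝓢(R3, Spinor), Bop (g.toLp 2) = (g.postcompCLM (matMap Bmatrix)).toLp 2 := by
    intro g
    refine Lp.ext ?_
    filter_upwards [Bop_ae (g.toLp 2), g.coeFn_toLp 2 volume,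
      (g.postcompCLM (matMap Bmatrix)).coeFn_toLp 2 volume] with x h1 h2 h3
    rw [h1, h2, h3, SchwartzMap.postcompCLM_apply]
  have hF : ∀ g : 𝓢(R3, Spinor), fourierL2 (g.toLp 2) = (𝓕 g).toLp 2 :=
    SchwartzMap.toLp_fourier_eq
  change fourierL2 (Bop (g.toLp 2)) = Bop (fourierL2 (g.toLp 2))
  rw [hB, hF, hF, hB]
  congr 1
  ext1 ξ
  rw [SchwartzMap.postcompCLM_apply]
  simp only [SchwartzMap.fourier_coe]
  rw [Real.fourier_eq, Real.fourier_eq, ← ContinuousLinearMap.integral_comp_comm]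
  · refine integral_congr_ae (Filter.Eventually.of_forall fun x => ?_)
    simp only [SchwartzMap.postcompCLM_apply, Circle.smul_def, map_smul]
  · exact (Real.fourierIntegral_convergent_iff ξ).mpr g.integrable

/-! ### The Sobolev space in Fourier space -/

theorem toTemperedDistribution_injective {f g : Hrel} (h : (f : 𝓢'(R3, Spinor)) = g) : f = g := by
  have hk := Lp.ker_toTemperedDistributionCLM_eq_bot (F := Spinor) (μ := (volume : Measure R3))
    (p := 2)
  rw [← sub_eq_zero]
  have : f - g ∈ (Lp.toTemperedDistributionCLM Spinor (volume : Measure R3) 2).ker := by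
    rw [LinearMap.mem_ker, ContinuousLinearMap.coe_coe, map_sub, sub_eq_zero]
    exact h
  rw [hk] at this
  simpa using this

/-- Membership in `H¹` in terms of the `L²` Fourier transform: `f̂ = (1 + |ξ|²)^(-1/2) g` with `g` in
`L²`. -/
theorem mem_sobolevOne_iff {f : Hrel} : f ∈ sobolevOne ↔ ∃ g : Hrel, fourierL2 f =ᵐ[volume]
    fun ξ => (((1 + ‖ξ‖ ^ 2) ^ (-1 / 2 : ℝ) : ℝ) : ℂ) • g ξ := by
  have hg₁ : (fun x : R3 => (((1 + ‖x‖ ^ 2) ^ (-1 / 2 : ℝ) : ℝ) : ℂ)).HasTemperateGrowth := by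
    fun_prop
  have hg₂ : MemLp (fun x : R3 => (((1 + ‖x‖ ^ 2) ^ (-1 / 2 : ℝ) : ℝ) : ℂ)) ⊤ volume := by
    refine memLp_top_of_bound (hg₁.1.continuous.aestronglyMeasurable) 1
      (Filter.Eventually.of_forall fun x => ?_)
    rw [Complex.norm_real, Real.norm_of_nonneg (by positivity)]
    exact Real.rpow_le_one_of_one_le_of_nonpos (by simp) (by norm_num)
  have hprod : (fun x : R3 => (((1 + ‖x‖ ^ 2) ^ (1 / 2 : ℝ) : ℝ) : ℂ)) *
      (fun x : R3 => (((1 + ‖x‖ ^ 2) ^ (-1 / 2 : ℝ) : ℝ) : ℂ)) = fun _ => 1 := by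
    ext x
    rw [Pi.mul_apply, ← Complex.ofReal_mul, ← Real.rpow_add (by positivity)]
    norm_num
  have hsmul (g : Hrel) : (((hg₂.toLp _) • g : Hrel) : 𝓢'(R3, Spinor)) = _ :=
    Lp.toTemperedDistribution_smul_eq (p := ⊤) (q := 2) (r := 2) hg₁ hg₂ g
  have hae (g : Hrel) : ((hg₂.toLp _) • g : Hrel) =ᵐ[volume]
      fun ξ => (((1 + ‖ξ‖ ^ 2) ^ (-1 / 2 : ℝ) : ℝ) : ℂ) • g ξ := by
    filter_upwards [Lp.coeFn_lpSMul (r := 2) (hg₂.toLp _) g, hg₂.coeFn_toLp] with x h1 h2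
    rw [h1, Pi.smul_apply', h2]
  have hF : (𝓕 (f : 𝓢'(R3, Spinor))) = ((fourierL2 f : Hrel) : 𝓢'(R3, Spinor)) :=
    Lp.fourier_toTemperedDistribution_eq f
  change TemperedDistribution.MemSobolev 1 2 (f : 𝓢'(R3, Spinor)) ↔ _
  rw [TemperedDistribution.memSobolev_iff_exists_smulLeftCLM_fourier, hF]
  refine exists_congr fun g => ⟨fun h => ?_, fun h => ?_⟩
  · have e : fourierL2 f = (hg₂.toLp _) • g := by
      apply toTemperedDistribution_injective
      rw [hsmul, ← h, TemperedDistribution.smulLeftCLM_smulLeftCLM_apply (by fun_prop) hg₁, hprod]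
      simp
    rw [e]
    exact hae g
  · have e : fourierL2 f = (hg₂.toLp _) • g := Lp.ext (h.trans (hae g).symm)
    rw [e, hsmul, TemperedDistribution.smulLeftCLM_smulLeftCLM_apply hg₁ (by fun_prop), mul_comm,
      hprod]
    simp

/-! ### The free operator -/

theorem eq_of_fourierL2_ae {f g : Hrel} (h : fourierL2 f =ᵐ[volume] fourierL2 g) : f = g :=
  fourierL2.injective (Lp.ext h)

theorem ae_momentum_ne_zero : ∀ᵐ ξ : R3, momentum ξ ≠ 0 := by
  filter_upwards [ae_ne_zero] with ξ h
  exact momentum_ne_zero h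

theorem matMap_mul (M N : Matrix Idx16 Idx16 ℂ) (v : Spinor) :
    matMap M (matMap N v) = matMap (M * N) v := by
  rw [matMap, matMap, matMap, map_mul, mul_apply_eq_comp]

theorem Pplus_Pplus (f : Hrel) : Pplus (Pplus f) = Pplus f := by
  refine eq_of_fourierL2_ae ?_
  filter_upwards [fourierL2_Pplus (Pplus f), fourierL2_Pplus f, ae_momentum_ne_zero] with ξ h1 h2 h3
  rw [h1, h2, matMap_mul, projSymbol_mul_self h3]

theorem mem_Hplus_iff {f : Hrel} : f ∈ Hplus ↔ Pplus f = f := by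
  constructor
  · rintro ⟨g, rfl⟩
    exact Pplus_Pplus g
  · intro h
    exact ⟨f, h⟩

/-- The symbol `(M⁻·p + B) P₊(p) / (4(p² + 1))` of the inverse of the free operator on `H₊`. -/
def freeInverseSymbol (p : R3) : Matrix Idx16 Idx16 ℂ :=
  (((energy p ^ 2)⁻¹ : ℝ) : ℂ) • (diracSymbol p * projSymbol p)

theorem norm_freeInverseSymbol_le (p : R3) (v : Spinor) :
    ‖matMap (freeInverseSymbol p) v‖ ≤ (energy p)⁻¹ * ‖v‖ := by
  have he := energy_pos p
  have h : matMap (freeInverseSymbol p) v = (((energy p ^ 2)⁻¹ : ℝ) : ℂ) •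
      matMap (diracSymbol p) (matMap (projSymbol p) v) := by
    rw [freeInverseSymbol, matMap_mul, matMap, map_smul, smul_apply]
  rw [h, norm_smul, Complex.norm_real, Real.norm_of_nonneg (by positivity)]
  calc _ ≤ (energy p ^ 2)⁻¹ * (energy p * ‖v‖) := by
        gcongr
        exact (norm_diracSymbol_le p _).trans (by gcongr; exact norm_projSymbol_le p v)
    _ = _ := by field_simp

theorem energy_inv_le (p : R3) : (energy p)⁻¹ ≤ 1 / 2 := by
  rw [one_div]
  exact inv_anti₀ (by norm_num) (two_le_energy p)

theorem measurable_alphaDot (i k : Idx4) : Measurable fun ξ : R3 => alphaDot (momentum ξ) i k := by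
  simp only [alphaDot, momentum, Matrix.sum_apply, Matrix.smul_apply, smul_eq_mul,
    PiLp.smul_apply]
  fun_prop

theorem measurable_diracSymbol (i k : Idx16) :
    Measurable fun ξ : R3 => diracSymbol (momentum ξ) i k := by
  have h := measurable_alphaDot
  simp only [diracSymbol, MminusDot_eq, Matrix.add_apply, Matrix.sub_apply,
    Matrix.kroneckerMap_apply]
  fun_prop

theorem measurable_projSymbol (i k : Idx16) :
    Measurable fun ξ : R3 => projSymbol (momentum ξ) i k := by
  have h := measurable_alphaDot
  have h2 : Measurable momentum := by
    unfold momentum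
    fun_prop
  simp only [projSymbol, tauMatrix, Matrix.neg_apply, Matrix.smul_apply, Matrix.add_apply,
      Matrix.kroneckerMap_apply, smul_eq_mul]
  fun_prop

theorem measurable_energy : Measurable fun ξ : R3 => energy (momentum ξ) := by
  unfold energy momentum
  fun_prop

theorem measurable_freeInverseSymbol (i k : Idx16) :
    Measurable fun ξ : R3 => freeInverseSymbol (momentum ξ) i k := by
  have h1 := measurable_diracSymbol
  have h2 := measurable_projSymbol
  have h3 := measurable_energy
  simp only [freeInverseSymbol, Matrix.smul_apply, Matrix.mul_apply, smul_eq_mul]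
  fun_prop

/-- The inverse of the free operator `M⁻·p̂ + B P₊` on `H₊`, extended by zero to `H₊^⊥`. -/
def freeInverse : Hrel →L[ℂ] Hrel :=
  fourierMulCLM (fun ξ => freeInverseSymbol (momentum ξ)) measurable_freeInverseSymbol (1 / 2)
    fun ξ v => (norm_freeInverseSymbol_le _ v).trans (by gcongr; exact energy_inv_le _)

theorem fourierL2_freeInverse (g : Hrel) : fourierL2 (freeInverse g) =ᵐ[volume]
    fun ξ => matMap (freeInverseSymbol (momentum ξ)) (fourierL2 g ξ) :=
  fourierL2_fourierMulCLM g

theorem norm_fourierL2_freeInverse_le (g : Hrel) : ∀ᵐ ξ,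
    ‖fourierL2 (freeInverse g) ξ‖ ≤ (energy (momentum ξ))⁻¹ * ‖fourierL2 g ξ‖ := by
  filter_upwards [fourierL2_freeInverse g] with ξ h
  rw [h]
  exact norm_freeInverseSymbol_le _ _

theorem rpow_neg_half_mul_energy_le (ξ : R3) :
    (1 + ‖ξ‖ ^ 2) ^ (-1 / 2 : ℝ) * energy (momentum ξ) ≤ 4 * π := by
  have h1 : (1 + ‖ξ‖ ^ 2) ^ (-1 / 2 : ℝ) = (√(1 + ‖ξ‖ ^ 2))⁻¹ := by
    rw [Real.sqrt_eq_rpow, ← Real.rpow_neg (by positivity)]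
    norm_num
  have h2 := norm_momentum ξ
  have hpi := Real.pi_gt_three
  have h3 : √(‖momentum ξ‖ ^ 2 + 1) ≤ 2 * π * √(1 + ‖ξ‖ ^ 2) := by
    rw [h2]
    refine Real.sqrt_le_iff.mpr ⟨by positivity, ?_⟩
    rw [mul_pow _ √_, Real.sq_sqrt (by positivity)]
    nlinarith
  rw [h1, energy, inv_mul_le_iff₀ (by positivity)]
  linarith

theorem energy_inv_mul_rpow_half_le (ξ : R3) :
    (energy (momentum ξ))⁻¹ * (1 + ‖ξ‖ ^ 2) ^ (1 / 2 : ℝ) ≤ 1 := by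
  have h2 := norm_momentum ξ
  have hpi := Real.pi_gt_three
  rw [inv_mul_le_iff₀ (energy_pos _), mul_one, ← Real.sqrt_eq_rpow, energy, h2]
  have : √(1 + ‖ξ‖ ^ 2) ≤ √((2 * π * ‖ξ‖) ^ 2 + 1) := by
    refine Real.sqrt_le_sqrt ?_
    rw [mul_pow, add_comm]
    have : 1 ≤ (2 * π) ^ 2 := by nlinarith
    nlinarith [sq_nonneg ‖ξ‖]
  linarith [Real.sqrt_nonneg (1 + ‖ξ‖ ^ 2)]

theorem freeInverse_mem_Dplus (g : Hrel) : freeInverse g ∈ Dplus := by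
  refine ⟨mem_sobolevOne_iff.mpr ?_, mem_Hplus_iff.mpr ?_⟩
  · have hmeas : AEStronglyMeasurable
        (fun ξ : R3 => (((1 + ‖ξ‖ ^ 2) ^ (1 / 2 : ℝ) : ℝ) : ℂ) • fourierL2 (freeInverse g) ξ) := by
      have h1 : Measurable fun ξ : R3 => (((1 + ‖ξ‖ ^ 2) ^ (1 / 2 : ℝ) : ℝ) : ℂ) := by fun_prop
      exact h1.aestronglyMeasurable.smul (Lp.memLp _).1
    have hm : MemLp (fun ξ : R3 => (((1 + ‖ξ‖ ^ 2) ^ (1 / 2 : ℝ) : ℝ) : ℂ) •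
        fourierL2 (freeInverse g) ξ) 2 volume := by
      refine (Lp.memLp (fourierL2 g)).mono hmeas ?_
      filter_upwards [norm_fourierL2_freeInverse_le g] with ξ h
      rw [norm_smul, Complex.norm_real, Real.norm_of_nonneg (by positivity)]
      calc _ ≤ (1 + ‖ξ‖ ^ 2) ^ (1 / 2 : ℝ) * ((energy (momentum ξ))⁻¹ * ‖fourierL2 g ξ‖) := by
            gcongr
        _ = ((energy (momentum ξ))⁻¹ * (1 + ‖ξ‖ ^ 2) ^ (1 / 2 : ℝ)) * ‖fourierL2 g ξ‖ := by ring
        _ ≤ 1 * ‖fourierL2 g ξ‖ := by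
            gcongr
            exact energy_inv_mul_rpow_half_le ξ
        _ = _ := one_mul _
    refine ⟨hm.toLp, ?_⟩
    filter_upwards [hm.coeFn_toLp] with ξ h
    rw [h, smul_smul, ← Complex.ofReal_mul, ← Real.rpow_add (by positivity)]
    norm_num
  · refine eq_of_fourierL2_ae ?_
    filter_upwards [fourierL2_Pplus (freeInverse g), fourierL2_freeInverse g,
      ae_momentum_ne_zero] with ξ h1 h2 h3
    rw [h1, h2, matMap_mul, freeInverseSymbol, Matrix.mul_smul, ← mul_assoc,
      projSymbol_mul_diracSymbol h3, mul_assoc, projSymbol_mul_self h3]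

theorem memLp_diracSymbol_of_mem_sobolevOne {f : Hrel} (hf : f ∈ sobolevOne) :
    MemLp (fun ξ => matMap (diracSymbol (momentum ξ)) (fourierL2 f ξ)) 2 volume := by
  obtain ⟨g, hg⟩ := mem_sobolevOne_iff.mp hf
  refine (Lp.memLp g).of_le_mul (c := 4 * π)
    (aestronglyMeasurable_matMap measurable_diracSymbol (Lp.memLp _).1) ?_
  filter_upwards [hg] with ξ h
  calc _ ≤ energy (momentum ξ) * ‖fourierL2 f ξ‖ := norm_diracSymbol_le _ _
    _ = ((1 + ‖ξ‖ ^ 2) ^ (-1 / 2 : ℝ) * energy (momentum ξ)) * ‖g ξ‖ := by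
        rw [h, norm_smul, Complex.norm_real, Real.norm_of_nonneg (by positivity)]
        ring
    _ ≤ _ := by
        exact mul_le_mul_of_nonneg_right (rpow_neg_half_mul_energy_le ξ) (norm_nonneg _)

theorem mem_domain_MminusP {f : Hrel} (hf : f ∈ sobolevOne) : f ∈ MminusP.domain := by
  change MemLp (fun ξ => matMap (MminusDot ((2 * Real.pi) • ξ)) (fourierL2 f ξ)) 2 volume
  refine (memLp_congr_ae ?_).mp ((memLp_diracSymbol_of_mem_sobolevOne hf).sub
    (Lp.memLp (Bop (fourierL2 f))))
  filter_upwards [Bop_ae (fourierL2 f)] with ξ h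
  rw [Pi.sub_apply, h, diracSymbol]
  simp only [matMap, map_add, add_apply, add_sub_cancel_right]
  rfl

theorem mem_domain_A0 {f : Hrel} (hf : f ∈ sobolevOne) : f ∈ A0.domain :=
  ⟨mem_domain_MminusP hf, trivial⟩

theorem fourierL2_A0 {f : Hrel} (hf : f ∈ Dplus) : fourierL2 (A0 ⟨f, mem_domain_A0 hf.1⟩) =ᵐ[volume]
    fun ξ => matMap (diracSymbol (momentum ξ)) (fourierL2 f ξ) := by
  have e : A0 ⟨f, mem_domain_A0 hf.1⟩ = MminusP ⟨f, mem_domain_MminusP hf.1⟩ + Bop f := by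
    change MminusP _ + Bop (Pplus f) = _
    rw [mem_Hplus_iff.mp hf.2]
    rfl
  rw [e, map_add, fourierL2_Bop]
  filter_upwards [Lp.coeFn_add (fourierL2 (MminusP ⟨f, mem_domain_MminusP hf.1⟩))
    (Bop (fourierL2 f)), Bop_ae (fourierL2 f),
    fourierL2_fourierMul (m := fun ξ => matMap (MminusDot ((2 * Real.pi) • ξ)))
      ⟨f, mem_domain_MminusP hf.1⟩] with ξ h1 h2 h3
  rw [h1, Pi.add_apply, h2]
  refine (congrArg (· + _) h3).trans ?_
  simp only [diracSymbol, matMap, map_add, add_apply]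
  rfl

theorem A0_freeInverse (g : Hrel) :
    A0 ⟨freeInverse g, mem_domain_A0 (freeInverse_mem_Dplus g).1⟩ = Pplus g := by
  refine eq_of_fourierL2_ae ?_
  filter_upwards [fourierL2_A0 (freeInverse_mem_Dplus g), fourierL2_freeInverse g,
    fourierL2_Pplus g, ae_momentum_ne_zero] with ξ h1 h2 h3 h4
  rw [h1, h2, h3, matMap_mul]
  congr 2
  have he : ((energy (momentum ξ) ^ 2 : ℝ) : ℂ) ≠ 0 := by
    exact_mod_cast (pow_pos (energy_pos _) 2).ne'
  rw [freeInverseSymbol, Matrix.mul_smul, ← mul_assoc, diracSymbol_mul_self, add_mul,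
    Matrix.smul_mul, projSymbol_mul_self h4, Matrix.smul_mul, one_mul, ← add_smul, smul_smul]
  have : ((4 * ‖momentum ξ‖ ^ 2 : ℝ) : ℂ) + 4 = ((energy (momentum ξ) ^ 2 : ℝ) : ℂ) := by
    rw [energy_sq]
    push_cast
    ring
  rw [this, Complex.ofReal_inv, inv_mul_cancel₀ he, one_smul]

theorem Pplus_A0 {f : Hrel} (hf : f ∈ Dplus) :
    Pplus (A0 ⟨f, mem_domain_A0 hf.1⟩) = A0 ⟨f, mem_domain_A0 hf.1⟩ := by
  refine eq_of_fourierL2_ae ?_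
  have hP : fourierL2 (Pplus f) = fourierL2 f := by rw [mem_Hplus_iff.mp hf.2]
  have hP' := fourierL2_Pplus f
  rw [hP] at hP'
  filter_upwards [fourierL2_Pplus (A0 ⟨f, mem_domain_A0 hf.1⟩), fourierL2_A0 hf, hP',
    ae_momentum_ne_zero] with ξ h1 h2 h3 h4
  rw [h1, h2, matMap_mul, projSymbol_mul_diracSymbol h4, ← matMap_mul, ← h3]

theorem freeInverse_A0 {f : Hrel} (hf : f ∈ Dplus) :
    freeInverse (A0 ⟨f, mem_domain_A0 hf.1⟩) = f := by
  refine eq_of_fourierL2_ae ?_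
  have hP : fourierL2 (Pplus f) = fourierL2 f := by rw [mem_Hplus_iff.mp hf.2]
  have hP' := fourierL2_Pplus f
  rw [hP] at hP'
  filter_upwards [fourierL2_freeInverse (A0 ⟨f, mem_domain_A0 hf.1⟩), fourierL2_A0 hf, hP',
    ae_momentum_ne_zero] with ξ h1 h2 h3 h4
  rw [h1, h2, matMap_mul, h3, matMap_mul]
  congr 2
  have he : ((energy (momentum ξ) ^ 2 : ℝ) : ℂ) ≠ 0 := by
    exact_mod_cast (pow_pos (energy_pos _) 2).ne'
  have h5 : ((4 * ‖momentum ξ‖ ^ 2 : ℝ) : ℂ) + 4 = ((energy (momentum ξ) ^ 2 : ℝ) : ℂ) := by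
    rw [energy_sq]
    push_cast
    ring
  rw [freeInverseSymbol, Matrix.smul_mul, Matrix.smul_mul, mul_assoc (diracSymbol _),
    projSymbol_mul_diracSymbol h4, mul_assoc, mul_assoc, projSymbol_mul_self h4, ← mul_assoc,
    diracSymbol_mul_self, add_mul, Matrix.smul_mul, projSymbol_mul_self h4, Matrix.smul_mul,
    one_mul, ← add_smul, smul_smul, h5, Complex.ofReal_inv, inv_mul_cancel₀ he, one_smul]

/-! ### Multiplication by the potential -/

/-- Multiplication by a real function, on its maximal domain. -/
abbrev realMulOp (w : R3 → ℝ) : Hrel →ₗ.[ℂ] Hrel :=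
  mulOp fun r => ((w r : ℝ) : ℂ) • ContinuousLinearMap.id ℂ Spinor

theorem realMulOp_ae {w : R3 → ℝ} (u : (realMulOp w).domain) :
    realMulOp w u =ᵐ[volume] fun r => ((w r : ℝ) : ℂ) • u.1 r :=
  MemLp.coeFn_toLp (mem_mulDomain.mp u.2)

theorem mem_realMulOp_domain {w : R3 → ℝ} {u : Hrel} :
    u ∈ (realMulOp w).domain ↔ MemLp (fun r => ((w r : ℝ) : ℂ) • u r) 2 volume := Iff.rfl

theorem enorm_ofReal_smul_sq (c : ℝ) (v : Spinor) :
    ‖(c : ℂ) • v‖ₑ ^ 2 = ENNReal.ofReal (c ^ 2) * ‖v‖ₑ ^ 2 := by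
  rw [enorm_smul, mul_pow, ← ofReal_norm (c : ℂ), Complex.norm_real, ← ENNReal.ofReal_pow
    (norm_nonneg _), Real.norm_eq_abs, sq_abs]

theorem mem_realMulOp_domain_of_lintegral {w : R3 → ℝ} (hw : Measurable w) {u : Hrel}
    (h : ∫⁻ r, ENNReal.ofReal (w r ^ 2) * ‖u r‖ₑ ^ 2 ≠ ⊤) : u ∈ (realMulOp w).domain := by
  rw [mem_realMulOp_domain]
  refine ⟨(Complex.measurable_ofReal.comp hw).aestronglyMeasurable.smul (Lp.memLp u).1, ?_⟩
  rw [eLpNorm_lt_top_iff_lintegral_rpow_enorm_lt_top (by norm_num) (by norm_num)]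
  simp only [ENNReal.toReal_ofNat, ENNReal.rpow_ofNat, enorm_ofReal_smul_sq]
  exact lt_top_iff_ne_top.mpr h

theorem enorm_realMulOp_sq {w : R3 → ℝ} (u : (realMulOp w).domain) :
    ‖realMulOp w u‖ₑ ^ 2 = ∫⁻ r, ENNReal.ofReal (w r ^ 2) * ‖u.1 r‖ₑ ^ 2 := by
  rw [← lintegral_enorm_sq]
  refine lintegral_congr_ae ?_
  filter_upwards [realMulOp_ae u] with r h
  rw [h, enorm_ofReal_smul_sq]

theorem inner_realMulOp {w : R3 → ℝ} (u z : (realMulOp w).domain) :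
    inner ℂ (realMulOp w u) z.1 = inner ℂ u.1 (realMulOp w z) := by
  rw [L2.inner_def, L2.inner_def]
  refine integral_congr_ae ?_
  filter_upwards [realMulOp_ae u, realMulOp_ae z] with r h1 h2
  rw [h1, h2, inner_smul_left, inner_smul_right, Complex.conj_ofReal]

/-- Multiplication by an everywhere defined real function is densely defined, as `g / (1 + |w|)` is
in its domain for every `g`. -/
theorem dense_realMulOp_domain {w : R3 → ℝ} (hw : Measurable w) :
    Dense ((realMulOp w).domain : Set Hrel) := by
  rw [Submodule.dense_iff_topologicalClosure_eq_top, Submodule.topologicalClosure_eq_top_iff,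
    Submodule.eq_bot_iff]
  intro g hg
  have hm : Measurable fun r => (((1 + |w r|)⁻¹ : ℝ) : ℂ) := by
    have : Measurable fun r => |w r| := by simpa using hw.norm
    fun_prop
  have hle (r : R3) : (1 + |w r|)⁻¹ ≤ 1 := inv_le_one_of_one_le₀ (by linarith [abs_nonneg (w r)])
  have hpos (r : R3) : 0 < (1 + |w r|)⁻¹ := inv_pos.mpr (by linarith [abs_nonneg (w r)])
  have h1 : MemLp (fun r => (((1 + |w r|)⁻¹ : ℝ) : ℂ) • g r) 2 volume := by
    refine (Lp.memLp g).mono (hm.aestronglyMeasurable.smul (Lp.memLp g).1)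
      (Filter.Eventually.of_forall fun r => ?_)
    rw [norm_smul, Complex.norm_real, Real.norm_of_nonneg (hpos r).le]
    exact mul_le_of_le_one_left (norm_nonneg _) (hle r)
  have h2 : h1.toLp ∈ (realMulOp w).domain := by
    rw [mem_realMulOp_domain]
    have h3 : MemLp (fun r => (w r : ℂ) • (((1 + |w r|)⁻¹ : ℝ) : ℂ) • g r) 2 volume := by
      refine (Lp.memLp g).mono ((Complex.measurable_ofReal.comp hw).aestronglyMeasurable.smul h1.1)
        (Filter.Eventually.of_forall fun r => ?_)
      rw [norm_smul, norm_smul, Complex.norm_real, Complex.norm_real,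
        Real.norm_of_nonneg (hpos r).le, ← mul_assoc, Real.norm_eq_abs]
      refine mul_le_of_le_one_left (norm_nonneg _) ?_
      rw [← div_eq_mul_inv]
      exact div_le_one_of_le₀ (by linarith) (by positivity)
    refine (memLp_congr_ae ?_).mp h3
    filter_upwards [h1.coeFn_toLp] with r hr
    rw [hr]
  have h4 := (Submodule.mem_orthogonal _ _).mp hg _ h2
  rw [L2.inner_def] at h4
  have h5 : ∫ r, (1 + |w r|)⁻¹ * ‖g r‖ ^ 2 = 0 := by
    have : ∫ r, inner ℂ ((h1.toLp : Hrel) r) (g r) = ((∫ r, (1 + |w r|)⁻¹ * ‖g r‖ ^ 2 : ℝ) : ℂ) := by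
      rw [← integral_complex_ofReal]
      refine integral_congr_ae ?_
      filter_upwards [h1.coeFn_toLp] with r hr
      rw [hr, inner_smul_left, Complex.conj_ofReal, inner_self_eq_norm_sq_to_K]
      push_cast
      rfl
    rw [this] at h4
    exact_mod_cast h4
  have hint : Integrable fun r => (1 + |w r|)⁻¹ * ‖g r‖ ^ 2 := by
    have hw' : Measurable fun r => (1 + |w r|)⁻¹ := by
      have : Measurable fun r => |w r| := by simpa using hw.norm
      fun_prop
    refine (Lp.memLp g).integrable_norm_pow (by norm_num) |>.bdd_mul
      (c := 1) hw'.aestronglyMeasurable (Filter.Eventually.of_forall fun r => ?_)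
    rw [Real.norm_of_nonneg (hpos r).le]
    exact hle r
  rw [integral_eq_zero_iff_of_nonneg (fun r => mul_nonneg (hpos r).le (by positivity)) hint] at h5
  refine Lp.ext ?_
  filter_upwards [h5, Lp.coeFn_zero Spinor 2 (volume : Measure R3)] with r h6 h7
  rw [h7]
  have := (mul_eq_zero.mp h6).resolve_left (hpos r).ne'
  simpa using this

theorem measurable_norm_rpow (s : ℝ) : Measurable fun r : R3 => ‖r‖ ^ s := by fun_prop

theorem measurable_sqrt_norm_rpow (s : ℝ) : Measurable fun r : R3 => √(‖r‖ ^ s) := by fun_prop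

/-- The operator `V` is the square of `V^(1/2)`. -/
theorem sqrtV_sqrtV {κ : ℝ} {u : Hrel} (hV : u ∈ (V κ).domain) (hu : u ∈ (sqrtV κ).domain) :
    ∃ h : sqrtV κ ⟨u, hu⟩ ∈ (sqrtV κ).domain, sqrtV κ ⟨_, h⟩ = V κ ⟨u, hV⟩ := by
  have e : ∀ᵐ r, ((√(‖r‖ ^ (-κ)) : ℝ) : ℂ) • (sqrtV κ ⟨u, hu⟩ : Hrel) r =
      ((‖r‖ ^ (-κ) : ℝ) : ℂ) • u r := by
    filter_upwards [realMulOp_ae (w := fun r => √(‖r‖ ^ (-κ))) ⟨u, hu⟩] with r h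
    refine (congrArg _ h).trans ?_
    rw [smul_smul, ← Complex.ofReal_mul, Real.mul_self_sqrt (by positivity)]
  have h1 : sqrtV κ ⟨u, hu⟩ ∈ (sqrtV κ).domain := (memLp_congr_ae e).mpr hV
  refine ⟨h1, Lp.ext ?_⟩
  filter_upwards [e, realMulOp_ae (w := fun r => √(‖r‖ ^ (-κ))) ⟨_, h1⟩,
    realMulOp_ae (w := fun r => ‖r‖ ^ (-κ)) ⟨u, hV⟩] with r h2 h3 h4
  exact h3.trans (h2.trans h4.symm)

/-! ### Herbst's inequality relative to the free operator -/

theorem norm_rpow_le_energy {κ : ℝ} (h0 : 0 ≤ κ) (h1 : κ ≤ 1) (p : R3) :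
    ‖p‖ ^ κ ≤ energy p / 2 := by
  have e : energy p / 2 = √(‖p‖ ^ 2 + 1) := by unfold energy; ring
  rw [e]
  rcases le_total ‖p‖ 1 with h | h
  · exact (Real.rpow_le_one (norm_nonneg _) h h0).trans
      (Real.one_le_sqrt.mpr (by nlinarith [norm_nonneg p]))
  · calc ‖p‖ ^ κ ≤ ‖p‖ ^ (1 : ℝ) := Real.rpow_le_rpow_of_exponent_le h h1
      _ = √(‖p‖ ^ 2) := by rw [Real.rpow_one, Real.sqrt_sq (norm_nonneg _)]
      _ ≤ _ := Real.sqrt_le_sqrt (by linarith)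

/-- The quadratic form `⟨g, (2√(p² + 1))⁻¹ g⟩`. -/
def energyForm (g : Hrel) : ℝ := ∫ ξ, (energy (momentum ξ))⁻¹ * ‖fourierL2 g ξ‖ ^ 2

theorem energyForm_nonneg (g : Hrel) : 0 ≤ energyForm g :=
  integral_nonneg fun ξ => mul_nonneg (inv_nonneg.mpr (energy_pos _).le) (by positivity)

theorem lintegral_energyForm (g : Hrel) :
    ∫⁻ ξ, ENNReal.ofReal (energy (momentum ξ))⁻¹ * ‖fourierL2 g ξ‖ₑ ^ 2 =
      ENNReal.ofReal (energyForm g) := by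
  have hint : Integrable fun ξ => (energy (momentum ξ))⁻¹ * ‖fourierL2 g ξ‖ ^ 2 := by
    refine (Lp.memLp (fourierL2 g)).integrable_norm_pow (by norm_num) |>.bdd_mul
      (c := 1 / 2) measurable_energy.inv.aestronglyMeasurable
      (Filter.Eventually.of_forall fun ξ => ?_)
    rw [Real.norm_of_nonneg (inv_nonneg.mpr (energy_pos _).le)]
    exact energy_inv_le _
  rw [energyForm, ofReal_integral_eq_lintegral_ofReal hint (Filter.Eventually.of_forall fun ξ =>
    mul_nonneg (inv_nonneg.mpr (energy_pos _).le) (by positivity))]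
  refine lintegral_congr fun ξ => ?_
  rw [ENNReal.ofReal_mul (inv_nonneg.mpr (energy_pos _).le), ENNReal.ofReal_pow (norm_nonneg _),
    ofReal_norm]

theorem le_of_enorm_sq_le {u : Hrel} {c : ℝ} (hc : 0 ≤ c) (h : ‖u‖ₑ ^ 2 ≤ ENNReal.ofReal c) :
    ‖u‖ ^ 2 ≤ c := by
  rw [← ofReal_norm, ← ENNReal.ofReal_pow (norm_nonneg _)] at h
  exact (ENNReal.ofReal_le_ofReal_iff hc).mp h

/-- The operator bound `‖V u‖ ≤ (M_κ / 2) ‖g‖` for `u = |A₀|⁻¹ g`. -/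
theorem norm_V_le {κ : ℝ} (h0 : 0 < κ) (h1 : κ ≤ 1) {u g : Hrel}
    (h : ∀ᵐ ξ, ‖fourierL2 u ξ‖ ≤ (energy (momentum ξ))⁻¹ * ‖fourierL2 g ξ‖) :
    ∃ hu : u ∈ (V κ).domain, ‖V κ ⟨u, hu⟩‖ ≤ Mconst κ / 2 * ‖g‖ := by
  have hM := Mconst_pos h0.le (by linarith)
  have key : ∫⁻ r, ENNReal.ofReal ((‖r‖ ^ (-κ)) ^ 2) * ‖u r‖ₑ ^ 2 ≤
      ENNReal.ofReal ((Mconst κ / 2 * ‖g‖) ^ 2) := by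
    calc _ = ∫⁻ r, ENNReal.ofReal (‖r‖ ^ (-(2 * κ))) * ‖u r‖ₑ ^ 2 := by
          refine lintegral_congr fun r => ?_
          rw [← Real.rpow_natCast, ← Real.rpow_mul (norm_nonneg _)]
          congr 3
          push_cast
          ring
      _ ≤ _ := lintegral_norm_rpow_le h0 (by linarith) u
      _ ≤ ENNReal.ofReal (Mconst κ ^ 2) *
          ∫⁻ ξ, ENNReal.ofReal (1 / 4) * ‖fourierL2 g ξ‖ₑ ^ 2 := by
          refine mul_le_mul_right (lintegral_mono_ae ?_) _
          filter_upwards [h] with ξ hξ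
          simp only [← ofReal_norm]
          rw [← ENNReal.ofReal_pow (norm_nonneg _), ← ENNReal.ofReal_pow (norm_nonneg _),
            ← ENNReal.ofReal_mul (by positivity), ← ENNReal.ofReal_mul (by positivity)]
          refine ENNReal.ofReal_le_ofReal ?_
          have he := energy_pos (momentum ξ)
          rw [← norm_momentum, mul_comm 2 κ, Real.rpow_mul (norm_nonneg _), Real.rpow_two]
          calc _ ≤ (energy (momentum ξ) / 2) ^ 2 *
                ((energy (momentum ξ))⁻¹ * ‖fourierL2 g ξ‖) ^ 2 := by
                gcongr
                exact norm_rpow_le_energy h0.le h1 _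
            _ = _ := by field_simp; ring
      _ = _ := by
          rw [lintegral_const_mul' _ _ ENNReal.ofReal_ne_top, lintegral_enorm_sq,
            LinearIsometryEquiv.enorm_map, ← ofReal_norm, ← ENNReal.ofReal_pow (norm_nonneg _),
            ← ENNReal.ofReal_mul (by positivity), ← ENNReal.ofReal_mul (by positivity)]
          congr 1
          ring
  have hu : u ∈ (V κ).domain := mem_realMulOp_domain_of_lintegral (measurable_norm_rpow (-κ))
    (ne_top_of_le_ne_top ENNReal.ofReal_ne_top key)
  refine ⟨hu, le_of_sq_le_sq (le_of_enorm_sq_le (by positivity) (le_trans (le_of_eq ?_) key))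
    (by positivity)⟩
  exact enorm_realMulOp_sq (w := fun r => ‖r‖ ^ (-κ)) ⟨u, hu⟩

/-- The form bound `‖V^(1/2) u‖² ≤ (M_{κ/2}² / 2) ⟨g, |A₀|⁻¹ g⟩` for `u = |A₀|⁻¹ g`. -/
theorem norm_sqrtV_sq_le {κ : ℝ} (h0 : 0 < κ) (h1 : κ ≤ 1) {u g : Hrel}
    (h : ∀ᵐ ξ, ‖fourierL2 u ξ‖ ≤ (energy (momentum ξ))⁻¹ * ‖fourierL2 g ξ‖) :
    ∃ hu : u ∈ (sqrtV κ).domain,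
      ‖sqrtV κ ⟨u, hu⟩‖ ^ 2 ≤ Mconst (κ / 2) ^ 2 / 2 * energyForm g := by
  have hM := Mconst_pos (κ := κ / 2) (by linarith) (by linarith)
  have hI := energyForm_nonneg g
  have key : ∫⁻ r, ENNReal.ofReal (√(‖r‖ ^ (-κ)) ^ 2) * ‖u r‖ₑ ^ 2 ≤
      ENNReal.ofReal (Mconst (κ / 2) ^ 2 / 2 * energyForm g) := by
    calc _ = ∫⁻ r, ENNReal.ofReal (‖r‖ ^ (-(2 * (κ / 2)))) * ‖u r‖ₑ ^ 2 := by
          refine lintegral_congr fun r => ?_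
          rw [Real.sq_sqrt (by positivity)]
          congr 4
          ring
      _ ≤ _ := lintegral_norm_rpow_le (by linarith) (by linarith) u
      _ ≤ ENNReal.ofReal (Mconst (κ / 2) ^ 2) * ∫⁻ ξ, ENNReal.ofReal (1 / 2) *
          (ENNReal.ofReal (energy (momentum ξ))⁻¹ * ‖fourierL2 g ξ‖ₑ ^ 2) := by
          refine mul_le_mul_right (lintegral_mono_ae ?_) _
          filter_upwards [h] with ξ hξ
          have he := energy_pos (momentum ξ)
          simp only [← ofReal_norm]
          rw [← ENNReal.ofReal_pow (norm_nonneg _), ← ENNReal.ofReal_pow (norm_nonneg _),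
            ← ENNReal.ofReal_mul (by positivity), ← ENNReal.ofReal_mul (by positivity),
            ← ENNReal.ofReal_mul (by positivity)]
          refine ENNReal.ofReal_le_ofReal ?_
          rw [← norm_momentum, show 2 * (κ / 2) = κ by ring]
          calc _ ≤ (energy (momentum ξ) / 2) *
                ((energy (momentum ξ))⁻¹ * ‖fourierL2 g ξ‖) ^ 2 := by
                gcongr
                exact norm_rpow_le_energy h0.le h1 _
            _ = _ := by field_simp
      _ = _ := by
          rw [lintegral_const_mul' _ _ ENNReal.ofReal_ne_top, lintegral_energyForm,
            ← ENNReal.ofReal_mul (by positivity), ← ENNReal.ofReal_mul (by positivity)]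
          congr 1
          ring
  have hu : u ∈ (sqrtV κ).domain :=
    mem_realMulOp_domain_of_lintegral (measurable_sqrt_norm_rpow (-κ))
      (ne_top_of_le_ne_top ENNReal.ofReal_ne_top key)
  refine ⟨hu, le_of_enorm_sq_le (by positivity) (le_trans (le_of_eq ?_) key)⟩
  exact enorm_realMulOp_sq (w := fun r => √(‖r‖ ^ (-κ))) ⟨u, hu⟩

theorem matMap_ofReal_smul_one (c : ℝ) (v : Spinor) :
    matMap ((c : ℂ) • (1 : Matrix Idx16 Idx16 ℂ)) v = (c : ℂ) • v := by
  rw [matMap, map_smul, map_one, smul_apply, one_apply_eq_self]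

/-- The bounded operator `(2√(p² + 1))⁻¹`. -/
def energyInv : Hrel →L[ℂ] Hrel :=
  fourierMulCLM (fun ξ => (((energy (momentum ξ))⁻¹ : ℝ) : ℂ) • (1 : Matrix Idx16 Idx16 ℂ))
    (fun i k => by
      have := measurable_energy
      simp only [Matrix.smul_apply, smul_eq_mul]
      fun_prop) (1 / 2)
    fun ξ v => by
      rw [matMap_ofReal_smul_one, norm_smul, Complex.norm_real,
        Real.norm_of_nonneg (inv_nonneg.mpr (energy_pos _).le)]
      gcongr
      exact energy_inv_le _

theorem fourierL2_energyInv (g : Hrel) : fourierL2 (energyInv g) =ᵐ[volume]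
    fun ξ => (((energy (momentum ξ))⁻¹ : ℝ) : ℂ) • fourierL2 g ξ := by
  filter_upwards [fourierL2_fourierMulCLM (m := fun ξ => (((energy (momentum ξ))⁻¹ : ℝ) : ℂ) •
    (1 : Matrix Idx16 Idx16 ℂ)) g] with ξ h
  exact h.trans (matMap_ofReal_smul_one _ _)

theorem inner_energyInv (g : Hrel) : inner ℂ (energyInv g) g = (energyForm g : ℂ) := by
  rw [← LinearIsometryEquiv.inner_map_map fourierL2, L2.inner_def, energyForm,
    ← integral_complex_ofReal]
  refine integral_congr_ae ?_
  filter_upwards [fourierL2_energyInv g] with ξ h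
  rw [h, inner_smul_left, Complex.conj_ofReal, inner_self_eq_norm_sq_to_K]
  push_cast
  rfl

/-- The form bound transposed: `‖|A₀|^(-1/2) V^(1/2) z‖² ≤ (M_{κ/2}² / 2) ‖z‖²`. -/
theorem energyForm_sqrtV_le {κ : ℝ} (h0 : 0 < κ) (h1 : κ ≤ 1) (z : (sqrtV κ).domain) :
    energyForm (sqrtV κ z) ≤ Mconst (κ / 2) ^ 2 / 2 * ‖z.1‖ ^ 2 := by
  set g := sqrtV κ z with hg
  have hq : 0 ≤ Mconst (κ / 2) ^ 2 / 2 := by positivity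
  have hb : ∀ᵐ ξ, ‖fourierL2 (energyInv g) ξ‖ ≤ (energy (momentum ξ))⁻¹ * ‖fourierL2 g ξ‖ := by
    filter_upwards [fourierL2_energyInv g] with ξ h
    rw [h, norm_smul, Complex.norm_real, Real.norm_of_nonneg (inv_nonneg.mpr (energy_pos _).le)]
  obtain ⟨hu, h2⟩ := norm_sqrtV_sq_le h0 h1 hb
  have hI := energyForm_nonneg g
  have h3 : energyForm g ≤ ‖sqrtV κ ⟨energyInv g, hu⟩‖ * ‖z.1‖ := by
    have e : inner ℂ (sqrtV κ ⟨energyInv g, hu⟩) z.1 = (energyForm g : ℂ) := by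
      rw [← inner_energyInv]
      exact inner_realMulOp (w := fun r => √(‖r‖ ^ (-κ))) ⟨energyInv g, hu⟩ z
    calc energyForm g = ‖(energyForm g : ℂ)‖ := by
          rw [Complex.norm_real, Real.norm_of_nonneg hI]
      _ ≤ _ := by
          rw [← e]
          exact norm_inner_le_norm _ _
  have h4 : energyForm g * energyForm g ≤
      (Mconst (κ / 2) ^ 2 / 2 * ‖z.1‖ ^ 2) * energyForm g := by
    calc _ ≤ (‖sqrtV κ ⟨energyInv g, hu⟩‖ * ‖z.1‖) * (‖sqrtV κ ⟨energyInv g, hu⟩‖ * ‖z.1‖) :=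
          mul_self_le_mul_self hI h3
      _ = ‖sqrtV κ ⟨energyInv g, hu⟩‖ ^ 2 * ‖z.1‖ ^ 2 := by ring
      _ ≤ (Mconst (κ / 2) ^ 2 / 2 * energyForm g) * ‖z.1‖ ^ 2 := by gcongr
      _ = _ := by ring
  rcases hI.eq_or_lt with h5 | h5
  · rw [← h5]
    positivity
  · exact le_of_mul_le_mul_right h4 h5

/-- `‖V^(1/2) A₀⁻¹ V^(1/2) z‖ ≤ (M_{κ/2}² / 2) ‖z‖`. -/
theorem norm_sqrtV_freeInverse_sqrtV_le {κ : ℝ} (h0 : 0 < κ) (h1 : κ ≤ 1) (z : (sqrtV κ).domain) :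
    ∃ hu : freeInverse (sqrtV κ z) ∈ (sqrtV κ).domain,
      ‖sqrtV κ ⟨_, hu⟩‖ ≤ Mconst (κ / 2) ^ 2 / 2 * ‖z.1‖ := by
  obtain ⟨hu, h2⟩ := norm_sqrtV_sq_le h0 h1 (norm_fourierL2_freeInverse_le (sqrtV κ z))
  refine ⟨hu, le_of_sq_le_sq (h2.trans ?_) (by positivity)⟩
  calc _ ≤ Mconst (κ / 2) ^ 2 / 2 * (Mconst (κ / 2) ^ 2 / 2 * ‖z.1‖ ^ 2) := by
        gcongr
        exact energyForm_sqrtV_le h0 h1 z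
    _ = _ := by ring

/-! ### The operator `A` -/

theorem norm_Pplus_le (g : Hrel) : ‖Pplus g‖ ≤ ‖g‖ := by
  rw [← LinearIsometryEquiv.norm_map fourierL2 (Pplus g), ← LinearIsometryEquiv.norm_map fourierL2 g]
  refine Lp.norm_le_norm_of_ae_le ?_
  filter_upwards [fourierL2_Pplus g] with ξ h
  rw [h]
  exact norm_projSymbol_le _ _

theorem freeInverse_Pplus (g : Hrel) : freeInverse (Pplus g) = freeInverse g := by
  rw [← A0_freeInverse, freeInverse_A0 (freeInverse_mem_Dplus g)]

theorem freeInverse_mem_V_domain {κ : ℝ} (h0 : 0 < κ) (h1 : κ ≤ 1) (g : Hrel) :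
    freeInverse g ∈ (V κ).domain :=
  (norm_V_le h0 h1 (norm_fourierL2_freeInverse_le g)).choose

theorem Dplus_le_V_domain {κ : ℝ} (h0 : 0 < κ) (h1 : κ ≤ 1) : Dplus ≤ (V κ).domain := fun f hf => by
  rw [← freeInverse_A0 hf]
  exact freeInverse_mem_V_domain h0 h1 _

theorem Dplus_le_sqrtV_domain {κ : ℝ} (h0 : 0 < κ) (h1 : κ ≤ 1) :
    Dplus ≤ (sqrtV κ).domain := fun f hf => by
  rw [← freeInverse_A0 hf]
  exact (norm_sqrtV_sq_le h0 h1 (norm_fourierL2_freeInverse_le _)).choose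

theorem mem_A_domain_iff {κ : ℝ} (γ : ℝ) (h0 : 0 < κ) (h1 : κ ≤ 1) {f : Hrel} :
    f ∈ (A κ γ).domain ↔ f ∈ Dplus := by
  rw [A, LinearPMap.domRestrict_domain, Submodule.mem_inf]
  refine ⟨fun h => h.1, fun h => ⟨h, mem_domain_A0 h.1, ?_⟩⟩
  refine ⟨⟨trivial, ?_⟩, trivial⟩
  change Pplus f ∈ (V κ).domain
  rw [mem_Hplus_iff.mp h.2]
  exact Dplus_le_V_domain h0 h1 h

theorem A_apply {κ : ℝ} (γ : ℝ) (h0 : 0 < κ) (h1 : κ ≤ 1) {f : Hrel} (hf : f ∈ Dplus) :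
    A κ γ ⟨f, (mem_A_domain_iff γ h0 h1).mpr hf⟩ = A0 ⟨f, mem_domain_A0 hf.1⟩ +
      (γ : ℂ) • Pplus (V κ ⟨f, Dplus_le_V_domain h0 h1 hf⟩) := by
  have e : ∀ h : Pplus f ∈ (V κ).domain, V κ ⟨Pplus f, h⟩ =
      V κ ⟨f, Dplus_le_V_domain h0 h1 hf⟩ := by
    rw [mem_Hplus_iff.mp hf.2]
    exact fun _ => rfl
  have hP : Pplus f ∈ (V κ).domain := by
    rw [mem_Hplus_iff.mp hf.2]
    exact Dplus_le_V_domain h0 h1 hf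
  change A0 ⟨f, _⟩ + Pplus ((γ : ℂ) • V κ ⟨Pplus f, hP⟩) = _
  rw [map_smul, e]

/-- The bounded operator `V A₀⁻¹`. -/
def potentialFreeInverse {κ : ℝ} (h0 : 0 < κ) (h1 : κ ≤ 1) : Hrel →L[ℂ] Hrel :=
  LinearMap.mkContinuous ((V κ).toFun ∘ₗ
    (freeInverse : Hrel →ₗ[ℂ] Hrel).codRestrict (V κ).domain (freeInverse_mem_V_domain h0 h1))
    (Mconst κ / 2) fun g => (norm_V_le h0 h1 (norm_fourierL2_freeInverse_le g)).choose_spec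

theorem potentialFreeInverse_apply {κ : ℝ} (h0 : 0 < κ) (h1 : κ ≤ 1) (g : Hrel) :
    potentialFreeInverse h0 h1 g = V κ ⟨freeInverse g, freeInverse_mem_V_domain h0 h1 g⟩ := rfl

/-- The operator `-γ P₊ V A₀⁻¹`, for which `A A₀⁻¹ = 1 - (-γ P₊ V A₀⁻¹)` on `H₊`. -/
def neumannTerm (γ : ℝ) {κ : ℝ} (h0 : 0 < κ) (h1 : κ ≤ 1) : Hrel →L[ℂ] Hrel :=
  (-γ : ℂ) • (Pplus ∘L potentialFreeInverse h0 h1)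

theorem neumannTerm_apply (γ : ℝ) {κ : ℝ} (h0 : 0 < κ) (h1 : κ ≤ 1) (g : Hrel) :
    neumannTerm γ h0 h1 g = -((γ : ℂ) • Pplus (potentialFreeInverse h0 h1 g)) := by
  rw [← neg_smul]
  rfl

theorem norm_neumannTerm_lt_one {γ κ : ℝ} (h0 : 0 < κ) (h1 : κ ≤ 1)
    (hγ : |γ| * Mconst (κ / 2) ^ 2 < 1) : ‖neumannTerm γ h0 h1‖ < 1 := by
  have hM := Mconst_pos h0.le (by linarith)
  refine lt_of_le_of_lt (ContinuousLinearMap.opNorm_le_bound _ (by positivity) fun g => ?_) hγ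
  calc ‖neumannTerm γ h0 h1 g‖ = |γ| * ‖Pplus (potentialFreeInverse h0 h1 g)‖ := by
        rw [neumannTerm_apply, norm_neg, norm_smul, Complex.norm_real, Real.norm_eq_abs]
    _ ≤ |γ| * (Mconst κ / 2 * ‖g‖) := by
        gcongr
        refine (norm_Pplus_le _).trans ?_
        exact (norm_V_le h0 h1 (norm_fourierL2_freeInverse_le g)).choose_spec
    _ ≤ |γ| * (2 * Mconst (κ / 2) ^ 2 / 2 * ‖g‖) := by
        gcongr
        exact Mconst_le h0.le h1
    _ = _ := by ring

theorem A_freeInverse {κ : ℝ} (γ : ℝ) (h0 : 0 < κ) (h1 : κ ≤ 1) (g : Hrel) :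
    A κ γ ⟨freeInverse g, (mem_A_domain_iff γ h0 h1).mpr (freeInverse_mem_Dplus g)⟩ =
      Pplus g - neumannTerm γ h0 h1 g := by
  rw [A_apply γ h0 h1 (freeInverse_mem_Dplus g), A0_freeInverse, neumannTerm_apply, sub_neg_eq_add,
    potentialFreeInverse_apply]

theorem Pplus_neumannTerm {κ : ℝ} (γ : ℝ) (h0 : 0 < κ) (h1 : κ ≤ 1) (g : Hrel) :
    Pplus (neumannTerm γ h0 h1 g) = neumannTerm γ h0 h1 g := by
  rw [neumannTerm_apply, map_neg, map_smul, Pplus_Pplus]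

theorem isUnit_one_sub_neumannTerm {γ κ : ℝ} (h0 : 0 < κ) (h1 : κ ≤ 1)
    (hγ : |γ| * Mconst (κ / 2) ^ 2 < 1) : IsUnit (1 - neumannTerm γ h0 h1) :=
  isUnit_one_sub_of_norm_lt_one (norm_neumannTerm_lt_one h0 h1 hγ)

theorem ker_A {γ κ : ℝ} (h0 : 0 < κ) (h1 : κ ≤ 1) (hγ : |γ| * Mconst (κ / 2) ^ 2 < 1) :
    LinearMap.ker (A κ γ).toFun = ⊥ := by
  rw [Submodule.eq_bot_iff]
  rintro ⟨f, hf⟩ hker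
  have hfD := (mem_A_domain_iff γ h0 h1).mp hf
  set g := A0 ⟨f, mem_domain_A0 hfD.1⟩ with hg
  have hgf : freeInverse g = f := freeInverse_A0 hfD
  have h2 : (1 - neumannTerm γ h0 h1) g = 0 := by
    have h3 := A_freeInverse γ h0 h1 g
    rw [hg, Pplus_A0 hfD, ← hg] at h3
    refine h3.symm.trans ?_
    refine Eq.trans ?_ (LinearMap.mem_ker.mp hker)
    congr 1
    exact Subtype.ext hgf
  have h4 : g = 0 := by
    obtain ⟨U, hU⟩ := (isUnit_one_sub_neumannTerm h0 h1 hγ).exists_left_inv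
    calc g = (U * (1 - neumannTerm γ h0 h1)) g := by rw [hU]; rfl
      _ = U 0 := by rw [← h2]; rfl
      _ = 0 := map_zero U
  refine Subtype.ext ?_
  change f = 0
  rw [← hgf, h4, map_zero]

theorem range_A {γ κ : ℝ} (h0 : 0 < κ) (h1 : κ ≤ 1) (hγ : |γ| * Mconst (κ / 2) ^ 2 < 1) :
    LinearMap.range (A κ γ).toFun = Hplus := by
  ext h
  constructor
  · rintro ⟨⟨f, hf⟩, rfl⟩
    have hfD := (mem_A_domain_iff γ h0 h1).mp hf
    rw [mem_Hplus_iff]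
    have e := A_apply γ h0 h1 hfD
    refine (congrArg Pplus e).trans (Eq.trans ?_ e.symm)
    rw [map_add, Pplus_A0 hfD, map_smul, Pplus_Pplus]
  · intro hh
    obtain ⟨U, hU⟩ := (isUnit_one_sub_neumannTerm h0 h1 hγ).exists_right_inv
    have h2 : U h - neumannTerm γ h0 h1 (U h) = h := congrArg (fun T : Hrel →L[ℂ] Hrel => T h) hU
    have h3 : Pplus (U h) = U h := by
      have e := sub_eq_iff_eq_add.mp h2
      rw [e, map_add, mem_Hplus_iff.mp hh, Pplus_neumannTerm]
    refine ⟨⟨freeInverse (U h), (mem_A_domain_iff γ h0 h1).mpr (freeInverse_mem_Dplus _)⟩, ?_⟩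
    refine (A_freeInverse γ h0 h1 (U h)).trans ?_
    rw [h3, h2]

/-! ### The Birman–Schwinger operator -/

theorem sqrtAbsV_apply {κ γ : ℝ} (u : (sqrtV κ).domain) :
    sqrtAbsV κ γ u = ((√|γ| : ℝ) : ℂ) • sqrtV κ u := rfl

/-- The value at `x` of the Birman–Schwinger operator, in terms of `y = A⁻¹ P₊ (|γ|V)^(1/2) x`. -/
theorem exists_sandwich_apply {γ κ : ℝ} (h0 : 0 < κ) (h1 : κ ≤ 1)
    (hγ : |γ| * Mconst (κ / 2) ^ 2 < 1) (x : (sqrtV κ).domain) :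
    ∃ (y : Hrel) (hy : y ∈ Dplus) (hx : x.1 ∈ (sandwich κ γ).domain),
      A κ γ ⟨y, (mem_A_domain_iff γ h0 h1).mpr hy⟩ = Pplus (sqrtAbsV κ γ x) ∧
      sandwich κ γ ⟨x.1, hx⟩ =
        ((√|γ| : ℝ) : ℂ) • sqrtV κ ⟨y, Dplus_le_sqrtV_domain h0 h1 hy⟩ := by
  have hr : Pplus (sqrtAbsV κ γ x) ∈ LinearMap.range (A κ γ).toFun := by
    rw [range_A h0 h1 hγ]
    exact ⟨_, rfl⟩
  have hinv : Pplus (sqrtAbsV κ γ x) ∈ (A κ γ).inverse.domain := by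
    rwa [LinearPMap.inverse_domain]
  obtain ⟨⟨y, hy⟩, hAy⟩ := id hr
  have hyD := (mem_A_domain_iff γ h0 h1).mp hy
  have e : (A κ γ).inverse ⟨_, hinv⟩ = y :=
    LinearPMap.inverse_apply_eq (ker_A h0 h1 hγ) (y := ⟨_, hinv⟩) (x := ⟨y, hy⟩) hAy
  have e2 : Pplus ((A κ γ).inverse ⟨_, hinv⟩) = y := by rw [e, mem_Hplus_iff.mp hyD.2]
  have hs : Pplus ((A κ γ).inverse ⟨_, hinv⟩) ∈ (sqrtV κ).domain := by
    rw [e2]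
    exact Dplus_le_sqrtV_domain h0 h1 hyD
  refine ⟨y, hyD, ⟨⟨⟨⟨x.2, trivial⟩, hinv⟩, trivial⟩, hs⟩, hAy, ?_⟩
  change ((√|γ| : ℝ) : ℂ) • sqrtV κ ⟨Pplus ((A κ γ).inverse ⟨_, hinv⟩), hs⟩ = _
  congr 2
  exact Subtype.ext e2

theorem sandwich_domain {γ κ : ℝ} (h0 : 0 < κ) (h1 : κ ≤ 1)
    (hγ : |γ| * Mconst (κ / 2) ^ 2 < 1) : (sandwich κ γ).domain = (sqrtV κ).domain := by
  ext x
  constructor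
  · rintro ⟨⟨⟨⟨hx, _⟩, _⟩, _⟩, _⟩
    exact hx
  · intro hx
    exact (exists_sandwich_apply h0 h1 hγ ⟨x, hx⟩).choose_spec.choose_spec.choose

theorem norm_sandwich_le {γ κ : ℝ} (h0 : 0 < κ) (h1 : κ ≤ 1)
    (hγ : |γ| * Mconst (κ / 2) ^ 2 < 1) (x : (sandwich κ γ).domain) :
    ‖sandwich κ γ x‖ ≤
      |γ| * Mconst (κ / 2) ^ 2 / (2 - |γ| * Mconst (κ / 2) ^ 2) * ‖x.1‖ := by
  obtain ⟨x, hx⟩ := x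
  have hxs : x ∈ (sqrtV κ).domain := by rwa [sandwich_domain h0 h1 hγ] at hx
  obtain ⟨y, hy, _, hAy, hsy⟩ := exists_sandwich_apply h0 h1 hγ ⟨x, hxs⟩
  have hys := Dplus_le_sqrtV_domain h0 h1 hy
  obtain ⟨hv, hvV⟩ := sqrtV_sqrtV (Dplus_le_V_domain h0 h1 hy) hys
  -- `A y = P₊ (|γ|V)^(1/2) x` says that `A₀ y = P₊ V^(1/2) z`.
  set z : (sqrtV κ).domain := ((√|γ| : ℝ) : ℂ) • ⟨x, hxs⟩ - (γ : ℂ) • ⟨_, hv⟩ with hz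
  have h3 : freeInverse (sqrtV κ z) = y := by
    rw [← freeInverse_A0 hy, ← freeInverse_Pplus]
    congr 1
    rw [A_apply γ h0 h1 hy, ← eq_sub_iff_add_eq, sqrtAbsV_apply, ← hvV] at hAy
    rw [hAy, hz, LinearPMap.map_sub, LinearPMap.map_smul, LinearPMap.map_smul, map_sub, map_smul,
      map_smul]
  obtain ⟨hu, hle⟩ := norm_sqrtV_freeInverse_sqrtV_le h0 h1 z
  have h4 : ‖sqrtV κ ⟨y, hys⟩‖ ≤ Mconst (κ / 2) ^ 2 / 2 * ‖z.1‖ := by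
    convert hle using 4
    exact h3.symm
  have h5 : ‖z.1‖ ≤ √|γ| * ‖x‖ + |γ| * ‖sqrtV κ ⟨y, hys⟩‖ := by
    refine (norm_sub_le _ _).trans (le_of_eq ?_)
    congr 1
    · exact (norm_smul _ _).trans (by
        rw [Complex.norm_real, Real.norm_of_nonneg (Real.sqrt_nonneg _)])
    · exact (norm_smul _ _).trans (by rw [Complex.norm_real, Real.norm_eq_abs])
  have h6 : ‖sandwich κ γ ⟨x, hx⟩‖ = √|γ| * ‖sqrtV κ ⟨y, hys⟩‖ := by
    rw [hsy, norm_smul, Complex.norm_real, Real.norm_of_nonneg (Real.sqrt_nonneg _)]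
  rw [h6, div_mul_eq_mul_div, le_div_iff₀ (by linarith)]
  set s := ‖sqrtV κ ⟨y, hys⟩‖ with hs
  have h7 : s * (2 - |γ| * Mconst (κ / 2) ^ 2) ≤ Mconst (κ / 2) ^ 2 * (√|γ| * ‖x‖) := by
    have := h4.trans (mul_le_mul_of_nonneg_left h5 (by positivity))
    nlinarith
  calc _ = √|γ| * (s * (2 - |γ| * Mconst (κ / 2) ^ 2)) := by ring
    _ ≤ √|γ| * (Mconst (κ / 2) ^ 2 * (√|γ| * ‖x‖)) := by gcongr
    _ = (√|γ| * √|γ|) * Mconst (κ / 2) ^ 2 * ‖x‖ := by ring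
    _ = _ := by rw [Real.mul_self_sqrt (abs_nonneg γ)]

end TwoBodyDirac

end

theorem mainTheorem5 (κ γ : ℝ) (hκ₀ : 0 < κ) (hκ₁ : κ ≤ 1)
    (hγ : |γ| * TwoBodyDirac.Mconst (κ / 2) ^ 2 < 1) :
    -- `A` is a bijection from `D₊` onto `H₊`, so that `A⁻¹ : H₊ → D₊` exists
    (TwoBodyDirac.A κ γ).domain = TwoBodyDirac.Dplus ∧
    LinearMap.ker (TwoBodyDirac.A κ γ).toFun = ⊥ ∧
    LinearMap.range (TwoBodyDirac.A κ γ).toFun = TwoBodyDirac.Hplus ∧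
    -- the operator is defined exactly on the dense subspace `D(V^(1/2))` and is bounded there
    (TwoBodyDirac.sandwich κ γ).domain = (TwoBodyDirac.sqrtV κ).domain ∧
    Dense ((TwoBodyDirac.sqrtV κ).domain : Set TwoBodyDirac.Hrel) ∧
    TwoBodyDirac.IsBoundedOp (TwoBodyDirac.sandwich κ γ) ∧
    -- the norm bound
    TwoBodyDirac.opNorm (TwoBodyDirac.sandwich κ γ) ≤
      |γ| * TwoBodyDirac.Mconst (κ / 2) ^ 2 / (2 - |γ| * TwoBodyDirac.Mconst (κ / 2) ^ 2) ∧
    |γ| * TwoBodyDirac.Mconst (κ / 2) ^ 2 / (2 - |γ| * TwoBodyDirac.Mconst (κ / 2) ^ 2) < 1 := by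
  refine ⟨Submodule.ext fun f => TwoBodyDirac.mem_A_domain_iff γ hκ₀ hκ₁,
    TwoBodyDirac.ker_A hκ₀ hκ₁ hγ, TwoBodyDirac.range_A hκ₀ hκ₁ hγ,
    TwoBodyDirac.sandwich_domain hκ₀ hκ₁ hγ,
    TwoBodyDirac.dense_realMulOp_domain (TwoBodyDirac.measurable_sqrt_norm_rpow (-κ)),
    ⟨_, TwoBodyDirac.norm_sandwich_le hκ₀ hκ₁ hγ⟩,
    csInf_le ⟨0, fun c hc => hc.1⟩ ⟨div_nonneg (by positivity) (by linarith),
      TwoBodyDirac.norm_sandwich_le hκ₀ hκ₁ hγ⟩, ?_⟩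
  rw [div_lt_one (by linarith)]
  linarith
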